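/- Let $P=\{x\in\mathbb{C}:\operatorname{Re}x>0\}$. For a sequence $(a(n))_{n\ge1}$ of complex numbers, suppose that there is a function $f$, analytic on $P$, with $f(n)=a(n)$ for all integers $n\ge 1$ and $|f(x)|\le Ke^{\alpha|x|}$ on $P$ for some $K>0$, $\alpha<\pi$, and a function $R$, analytic on $P$, with $R(x)-R(x+1)=f(x)$ on $P$, $|R(x)|\le Le^{\beta|x|}$ on $P$ for some $L>0$, $\beta<2\pi$, and $\int_1^2R(t)\,dt=0$. Then $R(1)$ is called the Ramanujan sum of the series and is written $\sum_{n\ge1}^{\mathcal R}a(n)$. Let $H_n=\sum_{j=1}^n\frac1j$, let $\gamma$ be the Euler–Mascheroni constant, let $\zeta$ be the Riemann zeta function, let $B_n(x)$ be the Bernoulli polynomials, defined by $\frac{ze^{xz}}{e^z-1}=\sum_{n\ge0}B_n(x)\frac{z^n}{n!}$, and $B_n=B_n(0)$. Write $x=y \bmod \mathbb{Q}$ for $x-y\in\mathbb{Q}$. Then, for every integer $k\ge0$, the Ramanujan sums $\sum_{n\ge1}^{\mathcal R}(1-n)^kH_n$ and $\sum_{n\ge1}^{\mathcal R}n^kH_n$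 exist and are uniquely determined, and the following hold. 1. For every integer $k\ge0$, $$\zeta'(-k)=\sum_{n\ge1}^{\mathcal R}(1-n)^kH_n-\gamma\,\frac{B_{k+1}(2)}{k+1}\mod\mathbb{Q}.$$ 2. For every integer $k\ge1$, $$\zeta'(-k)=\sum_{n\ge1}^{\mathcal R}(1-n)^kH_n-\gamma\left(\frac{B_{k+1}}{k+1}+1\right)\mod\mathbb{Q}.$$ 3. For every integer $k\ge1$, $$\sum_{n\ge1}^{\mathcal R}n^kH_n=\gamma\,\frac{1-B_{k+1}}{k+1}-\log\sqrt{2\pi}+\sum_{m=1}^k\binom km(-1)^m\zeta'(-m)\mod\mathbb{Q}.$$ 4. For $k=0$, exactly, $$\sum_{n\ge1}^{\mathcal R}H_n=\frac32\gamma-\log\sqrt{2\pi}+\frac12.$$ -/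

import Mathlib

open scoped Real

/-- The open right half-plane `P = {x : Re x > 0}`. -/
def rightHalfPlane : Set ℂ := {x | 0 < x.re}

/-- `f` is analytic on the right half-plane and `|f x| ≤ K exp (α |x|)` there, for some constants
`K > 0` and `α < τ`. -/
def AnalyticOfTypeLT (τ : ℝ) (f : ℂ → ℂ) : Prop :=
  AnalyticOnNhd ℂ f rightHalfPlane ∧
    ∃ α < τ, ∃ K > 0, ∀ x ∈ rightHalfPlane, ‖f x‖ ≤ K * Real.exp (α * ‖x‖)

/-- `R` is the solution `R_f` of the difference equation `R x - R (x + 1) = f x` on the right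
half-plane that is analytic of exponential type less than `2π` and normalized by
`∫ t in 1..2, R t = 0`. -/
def IsRamanujanRemainder (f R : ℂ → ℂ) : Prop :=
  AnalyticOfTypeLT (2 * π) R ∧
    (∀ x ∈ rightHalfPlane, R x - R (x + 1) = f x) ∧
    ∫ t in (1 : ℝ)..2, R (t : ℂ) = 0

/-- The series `∑_{n ≥ 1} a n` has Ramanujan sum `S`: there is a function `f`, analytic on the right
half-plane and of exponential type less than `π`, with `f n = a n` for all `n ≥ 1`, and
`S = R_f 1`. (The value `a 0` is irrelevant.) -/
def HasRamanujanSum (a : ℕ → ℂ) (S : ℂ) : Prop :=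
  ∃ f R : ℂ → ℂ, AnalyticOfTypeLT π f ∧ (∀ n : ℕ, 1 ≤ n → f (n : ℂ) = a n) ∧
    IsRamanujanRemainder f R ∧ R 1 = S

open Classical in
/-- The Ramanujan sum of the series `∑_{n ≥ 1} a n` (with the value `0` if there is none). -/
noncomputable def ramanujanSum (a : ℕ → ℂ) : ℂ :=
  if h : ∃ S, HasRamanujanSum a S then h.choose else 0

/-- `x = y mod ℚ`: the difference `x - y` is a rational number. -/
def EqModRat (x y : ℂ) : Prop := ∃ q : ℚ, x - y = (q : ℂ)

/-!
# Ramanujan sums of `n ^ k H_n` and the values `ζ'(-k)` modulo `ℚ`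

*Uniqueness.* Two interpolating functions of type less than `π` agree by Carlson's theorem
(`AnalyticOfTypeLT.eq_zero_of_natCast_eq_zero`). The two remainders then differ by a `1`-periodic
function of type less than `2π`, which is constant (`AnalyticOfTypeLT.eq_of_periodic`) and vanishes
by the normalization of the integral.

*Existence.* The harmonic numbers are interpolated by `H x = ∑ n ≥ 1, (1 / n - 1 / (n + x))`
(`complexHarmonic`), with `H (x + 1) = H x + 1 / (x + 1)`. If `q` is a polynomial antidifference of
`p`, summation by parts solves the difference equation for `p x * H x` in closed form
(`hasRamanujanSum_aeval_mul_harmonic`), and since `∫ y in 0..1, H y = γ` the Ramanujan sum of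
`p(n) H_n` is, modulo `ℚ`, equal to `-q(0) γ + ∫ y in 0..1, q (y + 1) * H y`. For the summands at
hand `q` is, up to a factor, the Bernoulli polynomial `B_{k+1}(x)` or `B_{k+1}(x - 1)`.

*Link with zeta.* In the Euler–Maclaurin formula
`ζ(s) = 1 / (s - 1) + (rational polynomial) - (s)_m / m! * ∫ t ≥ 1, B_m({t}) t ^ (-s - m)`
with `m = k + 2`, the Pochhammer factor `(s)_m` has a simple zero at `s = -k`, so that only the value
`∫ t ≥ 1, B_{k+2}({t}) / t ^ 2` of the remainder integral enters `ζ'(-k)`. Summing over the intervals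
`[n, n + 1]` and integrating by parts turns this value into `∫ y in 0..1, B_{k+1}(y) * H y`
(`eulerMaclaurinIntegral_neg`, `deriv_riemannZeta_neg_eq`). The formulas of the theorem then follow
from the reflection formula and the Appell property of the Bernoulli polynomials, and the value
`ζ'(0) = -log √(2π)`.
-/

section

open Filter Topology Asymptotics Bornology

/-! ### Functions of exponential type on the right half-plane -/

theorem isOpen_rightHalfPlane : IsOpen rightHalfPlane :=
  isOpen_lt continuous_const Complex.continuous_re

theorem convex_rightHalfPlane : Convex ℝ rightHalfPlane :=
  convex_halfSpace_re_gt 0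

theorem AnalyticOfTypeLT.sub {τ : ℝ} {f g : ℂ → ℂ} (hf : AnalyticOfTypeLT τ f)
    (hg : AnalyticOfTypeLT τ g) : AnalyticOfTypeLT τ (fun x => f x - g x) := by
  obtain ⟨hf, α, hα, K, hK, hfK⟩ := hf
  obtain ⟨hg, β, hβ, L, hL, hgL⟩ := hg
  refine ⟨hf.sub hg, max α β, max_lt hα hβ, K + L, by positivity, fun x hx => ?_⟩
  have h1 : Real.exp (α * ‖x‖) ≤ Real.exp (max α β * ‖x‖) := by
    gcongr; exact le_max_left _ _
  have h2 : Real.exp (β * ‖x‖) ≤ Real.exp (max α β * ‖x‖) := by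
    gcongr; exact le_max_right _ _
  calc ‖f x - g x‖ ≤ ‖f x‖ + ‖g x‖ := norm_sub_le _ _
    _ ≤ K * Real.exp (α * ‖x‖) + L * Real.exp (β * ‖x‖) := add_le_add (hfK x hx) (hgL x hx)
    _ ≤ K * Real.exp (max α β * ‖x‖) + L * Real.exp (max α β * ‖x‖) := by gcongr
    _ = _ := by ring

/-- The exponent in the growth bound may be taken nonnegative. -/
theorem AnalyticOfTypeLT.exists_nonneg {τ : ℝ} (hτ : 0 < τ) {f : ℂ → ℂ}
    (hf : AnalyticOfTypeLT τ f) :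
    ∃ a, 0 ≤ a ∧ a < τ ∧ ∃ K > 0, ∀ x ∈ rightHalfPlane, ‖f x‖ ≤ K * Real.exp (a * ‖x‖) := by
  obtain ⟨-, α, hα, K, hK, hfK⟩ := hf
  refine ⟨max α 0, le_max_right _ _, max_lt hα hτ, K, hK, fun x hx => (hfK x hx).trans ?_⟩
  gcongr; exact le_max_left _ _

/-! ### Division by the sine -/

theorem norm_sin_pi_mul_sq (z : ℂ) :
    ‖Complex.sin (π * z)‖ ^ 2 = Real.sin (π * z.re) ^ 2 + Real.sinh (π * z.im) ^ 2 := by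
  have h : Complex.sin (π * z) =
      ((Real.sin (π * z.re) * Real.cosh (π * z.im) : ℝ) : ℂ) +
        ((Real.cos (π * z.re) * Real.sinh (π * z.im) : ℝ) : ℂ) * Complex.I := by
    rw [Complex.sin_eq]
    simp
  rw [h, ← Complex.normSq_eq_norm_sq, Complex.normSq_add_mul_I, mul_pow, mul_pow, Real.cosh_sq,
    Real.cos_sq']
  ring

theorem one_le_norm_sin_of_one_le_abs_im {z : ℂ} (hz : 1 ≤ |z.im|) :
    1 ≤ ‖Complex.sin (π * z)‖ := by
  have h := norm_sin_pi_mul_sq z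
  have h1 : 1 ≤ |π * z.im| := by
    rw [abs_mul, abs_of_pos Real.pi_pos]
    nlinarith [Real.pi_gt_three]
  have h2 : |π * z.im| ≤ |Real.sinh (π * z.im)| := by
    rw [Real.abs_sinh]; exact Real.self_le_sinh_iff.2 (abs_nonneg _)
  have h3 : 1 ≤ Real.sinh (π * z.im) ^ 2 := by
    rw [← sq_abs]; nlinarith
  nlinarith [norm_nonneg (Complex.sin (π * z)), sq_nonneg (Real.sin (π * z.re))]

theorem norm_sin_of_re_eq {z : ℂ} {n : ℤ} (hz : z.re = n + 1 / 2) :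
    ‖Complex.sin (π * z)‖ = Real.cosh (π * z.im) := by
  have h := norm_sin_pi_mul_sq z
  have h1 : Real.sin (π * z.re) ^ 2 = 1 := by
    have : Real.cos (π * z.re) = 0 := Real.cos_eq_zero_iff.2 ⟨n, by rw [hz]; ring⟩
    rw [Real.sin_sq, this]; norm_num
  rw [h1, add_comm, ← Real.cosh_sq] at h
  exact (pow_left_inj₀ (norm_nonneg _) (Real.cosh_pos _).le two_ne_zero).1 h

/-- The singularities of `φ / sin (π z)` at the zeros `1, 2, …` of `φ` are removable. -/
theorem exists_mul_sin_eq {φ : ℂ → ℂ} (hφ : DifferentiableOn ℂ φ rightHalfPlane)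
    (h0 : ∀ n : ℕ, 1 ≤ n → φ n = 0) :
    ∃ G : ℂ → ℂ, DifferentiableOn ℂ G rightHalfPlane ∧
      ∀ z ∈ rightHalfPlane, G z * Complex.sin (π * z) = φ z := by
  classical
  set σ : ℂ → ℂ := fun z => Complex.sin (π * z) with hσ
  have hσd : Differentiable ℂ σ := by fun_prop
  have hpi : (π : ℂ) ≠ 0 := by exact_mod_cast Real.pi_ne_zero
  have hσ' : ∀ z, deriv σ z = Complex.cos (π * z) * π := fun z => by
    have : HasDerivAt σ (Complex.cos (π * z) * (π * 1)) z :=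
      ((hasDerivAt_id z).const_mul (π : ℂ)).csin
    simpa using this.deriv
  have hzero : ∀ z ∈ rightHalfPlane, σ z = 0 → φ z = 0 := by
    intro z hz h
    obtain ⟨n, hn⟩ := Complex.sin_eq_zero_iff.1 h
    have hzn : z = n := by
      rw [mul_comm] at hn; exact mul_right_cancel₀ hpi hn
    have hpos : 0 < n := by
      have : 0 < z.re := hz
      rw [hzn] at this; simpa using this
    lift n to ℕ using hpos.le
    rw [hzn]
    exact_mod_cast h0 n (by exact_mod_cast hpos)
  refine ⟨fun z => if σ z = 0 then deriv φ z / deriv σ z else φ z / σ z, fun z hz => ?_,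
    fun z hz => ?_⟩
  · apply DifferentiableAt.differentiableWithinAt
    have hnhds : rightHalfPlane ∈ 𝓝 z := isOpen_rightHalfPlane.mem_nhds hz
    by_cases h : σ z = 0
    · have hdσ : DifferentiableAt ℂ (dslope σ z) z :=
        ((Complex.differentiableOn_dslope univ_mem).2 hσd.differentiableOn).differentiableAt
          univ_mem
      have hdφ : DifferentiableAt ℂ (dslope φ z) z :=
        ((Complex.differentiableOn_dslope hnhds).2 hφ).differentiableAt hnhds
      have hne : dslope σ z z ≠ 0 := by
        rw [dslope_same, hσ']
        refine mul_ne_zero (fun hc => ?_) hpi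
        have := Complex.sin_sq_add_cos_sq (π * z)
        rw [hc, show Complex.sin (π * z) = 0 from h] at this
        norm_num at this
      have hev := hdσ.continuousAt.eventually_ne hne
      refine (hdφ.div hdσ hne).congr_of_eventuallyEq ?_
      filter_upwards [hev] with w hw
      by_cases hwz : w = z
      · subst hwz
        simp [h, dslope_same]
      · have e1 : σ w = (w - z) * dslope σ z w := by
          rw [dslope_of_ne _ hwz, slope_def_field, h]
          field_simp [sub_ne_zero.2 hwz]; ring
        have e2 : φ w = (w - z) * dslope φ z w := by
          rw [dslope_of_ne _ hwz, slope_def_field, hzero z hz h]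
          field_simp [sub_ne_zero.2 hwz]; ring
        have e3 : σ w ≠ 0 := by
          rw [e1]; exact mul_ne_zero (sub_ne_zero.2 hwz) hw
        simp only [e3, if_false, Pi.div_apply]
        rw [e1, e2, mul_div_mul_left _ _ (sub_ne_zero.2 hwz)]
    · have hev : ∀ᶠ w in 𝓝 z, σ w ≠ 0 := hσd.continuous.continuousAt.eventually_ne h
      refine ((hφ.differentiableAt hnhds).div hσd.differentiableAt h).congr_of_eventuallyEq ?_
      filter_upwards [hev] with w hw
      simp [hw]
  · by_cases h : σ z = 0
    · simp [hzero z hz h, show Complex.sin (π * z) = 0 from h]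
    · simp only [h, if_false]
      exact div_mul_cancel₀ _ h

/-- Off the boxes around the integers the sine is at least `1`, and the maximum principle carries
the bound for `φ` into the boxes. -/
theorem norm_le_of_mul_sin_eq {φ G : ℂ → ℂ} {a K : ℝ} (ha : 0 ≤ a) (hK : 0 < K)
    (hG : DifferentiableOn ℂ G rightHalfPlane)
    (hGφ : ∀ z ∈ rightHalfPlane, G z * Complex.sin (π * z) = φ z)
    (hφ : ∀ z ∈ rightHalfPlane, ‖φ z‖ ≤ K * Real.exp (a * ‖z‖)) {z : ℂ} (hz : 1 / 2 ≤ z.re) :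
    ‖G z‖ ≤ K * Real.exp (a * (‖z‖ + 3)) := by
  have key : ∀ w ∈ rightHalfPlane, 1 ≤ ‖Complex.sin (π * w)‖ → ‖w‖ ≤ ‖z‖ + 3 →
      ‖G w‖ ≤ K * Real.exp (a * (‖z‖ + 3)) := by
    intro w hw h1 h2
    calc ‖G w‖ ≤ ‖G w‖ * ‖Complex.sin (π * w)‖ := le_mul_of_one_le_right (norm_nonneg _) h1
      _ = ‖φ w‖ := by rw [← norm_mul, hGφ w hw]
      _ ≤ K * Real.exp (a * ‖w‖) := hφ w hw
      _ ≤ _ := by gcongr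
  have hzP : z ∈ rightHalfPlane := by
    show 0 < z.re
    linarith
  rcases le_or_gt 1 |z.im| with him | him
  · exact key z hzP (one_le_norm_sin_of_one_le_abs_im him) (by linarith)
  set n : ℤ := ⌊z.re - 1 / 2⌋ with hn
  have hn1 : (n : ℝ) + 1 / 2 ≤ z.re := by linarith [Int.floor_le (z.re - 1 / 2)]
  have hn2 : z.re < (n : ℝ) + 1 + 1 / 2 := by linarith [Int.lt_floor_add_one (z.re - 1 / 2)]
  have hn0 : (0 : ℝ) ≤ n := by
    exact_mod_cast Int.floor_nonneg.2 (by linarith : (0 : ℝ) ≤ z.re - 1 / 2)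
  set U : Set ℂ := Set.Ioo ((n : ℝ) + 1 / 2) (n + 1 + 1 / 2) ×ℂ Set.Ioo (-1 : ℝ) 1 with hU
  have hcl : closure U = Set.Icc ((n : ℝ) + 1 / 2) (n + 1 + 1 / 2) ×ℂ Set.Icc (-1 : ℝ) 1 := by
    rw [hU, Complex.closure_reProdIm, closure_Ioo (by linarith), closure_Ioo (by norm_num)]
  have hUP : closure U ⊆ rightHalfPlane := by
    intro w hw
    rw [hcl, Complex.mem_reProdIm] at hw
    have := hw.1.1
    show 0 < w.re
    linarith
  refine Complex.norm_le_of_forall_mem_frontier_norm_le (U := U) ?_ ?_ ?_ ?_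
  · exact (Metric.isBounded_Ioo _ _).reProdIm (Metric.isBounded_Ioo _ _)
  · exact (hG.mono hUP).diffContOnCl
  · intro w hw
    have hwc : w ∈ closure U := frontier_subset_closure hw
    have hwP := hUP hwc
    rw [hcl, Complex.mem_reProdIm] at hwc
    obtain ⟨⟨h1, h2⟩, h3, h4⟩ := hwc
    refine key w hwP ?_ ?_
    · rw [hU, Complex.frontier_reProdIm, frontier_Ioo (by linarith), frontier_Ioo (by norm_num)]
        at hw
      rcases hw with hw | hw
      · refine one_le_norm_sin_of_one_le_abs_im ?_
        rcases hw.2 with h | h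
        · rw [h]; norm_num
        · rw [Set.mem_singleton_iff.1 h]; norm_num
      · rcases hw.1 with h | h
        · rw [norm_sin_of_re_eq (n := n) h]; exact Real.one_le_cosh _
        · rw [norm_sin_of_re_eq (n := n + 1) (by rw [Set.mem_singleton_iff.1 h]; push_cast; ring)]
          exact Real.one_le_cosh _
    · have h5 : ‖w - z‖ ≤ |(w - z).re| + |(w - z).im| := Complex.norm_le_abs_re_add_abs_im _
      have h6 : |(w - z).re| ≤ 1 := by
        rw [Complex.sub_re, abs_le]; constructor <;> linarith
      have h7 : |(w - z).im| ≤ 2 := by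
        rw [abs_lt] at him
        rw [Complex.sub_im, abs_le]; constructor <;> linarith
      have h8 : ‖w‖ ≤ ‖z‖ + ‖w - z‖ := by
        simpa using norm_add_le z (w - z)
      linarith
  · rw [hcl, Complex.mem_reProdIm]
    rw [abs_lt] at him
    exact ⟨⟨hn1, hn2.le⟩, him.1.le, him.2.le⟩

/-! ### Carlson's theorem -/

theorem norm_log_one_add_le {w : ℂ} (hw : 0 ≤ w.re) :
    ‖Complex.log (1 + w)‖ ≤ Real.log (1 + ‖w‖) + π := by
  have h1 : 1 ≤ ‖1 + w‖ := by
    refine le_trans ?_ (Complex.re_le_norm _)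
    simpa using hw
  have h2 : ‖1 + w‖ ≤ 1 + ‖w‖ := by simpa using norm_add_le 1 w
  refine (Complex.norm_le_abs_re_add_abs_im _).trans (add_le_add ?_ ?_)
  · rw [Complex.log_re, abs_of_nonneg (Real.log_nonneg h1)]
    exact Real.log_le_log (by linarith) h2
  · rw [Complex.log_im]; exact Complex.abs_arg_le_pi _

/-- A function of exponential type on the right half-plane that decays exponentially along the
imaginary axis is zero. The factor `exp (-c w log (1 + w))` grows at most like `exp (c π |w|)` on the
imaginary axis, so for `c = δ / π` it is absorbed by the decay there, while on the positive real axis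
it decays superexponentially; Phragmén–Lindelöf applies to the product. -/
theorem eqOn_zero_of_exp_decay_on_imaginary_axis {G : ℂ → ℂ} {a K δ C : ℝ} (ha : 0 ≤ a)
    (hK : 0 < K) (hδ : 0 < δ) (hG : DiffContOnCl ℂ G {z | 0 < z.re})
    (hGK : ∀ z : ℂ, 0 ≤ z.re → ‖G z‖ ≤ K * Real.exp (a * ‖z‖))
    (hC : ∀ y : ℝ, ‖G (y * Complex.I)‖ ≤ C * Real.exp (-δ * |y|)) :
    Set.EqOn G 0 {z | 0 ≤ z.re} := by
  set c : ℝ := δ / π with hc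
  have hc0 : 0 < c := div_pos hδ Real.pi_pos
  set E : ℂ → ℂ := fun w => Complex.exp (-c * (w * Complex.log (1 + w))) with hE
  have hEn : ∀ w : ℂ, ‖E w‖ = Real.exp (-c * (w * Complex.log (1 + w)).re) := fun w => by
    rw [hE, Complex.norm_exp]
    congr 1
    rw [← Complex.ofReal_neg, Complex.re_ofReal_mul]
  have hEd : DifferentiableOn ℂ E {z | -1 < z.re} := by
    intro w hw
    have hw' : 1 + w ∈ Complex.slitPlane := by
      left
      have : -1 < w.re := hw
      simp; linarith
    have : DifferentiableAt ℂ (fun w => Complex.log (1 + w)) w :=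
      (differentiableAt_id.const_add 1).clog hw'
    exact (((differentiableAt_id.mul this).const_mul _).cexp).differentiableWithinAt
  have hcl : closure {z : ℂ | 0 < z.re} ⊆ {z : ℂ | -1 < z.re} := by
    rw [Complex.closure_setOfPred_lt_re]
    intro z hz
    have : 0 ≤ z.re := hz
    show -1 < z.re
    linarith
  have hW : Set.EqOn (fun w => E w • G w) 0 {z : ℂ | 0 ≤ z.re} := by
    refine PhragmenLindelof.eq_zero_on_right_half_plane_of_superexponential_decay
      ((hEd.mono hcl).diffContOnCl.smul hG) ⟨3 / 2, by norm_num, a + c * (4 + π), ?_⟩ ?_ ?_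
    · refine IsBigO.of_bound K ?_
      have h1 : ∀ᶠ z : ℂ in cobounded ℂ ⊓ 𝓟 {z | 0 < z.re}, 1 ≤ ‖z‖ :=
        (tendsto_norm_cobounded_atTop.eventually_ge_atTop 1).filter_mono inf_le_left
      have h2 : ∀ᶠ z : ℂ in cobounded ℂ ⊓ 𝓟 {z | 0 < z.re}, z ∈ {z : ℂ | 0 < z.re} :=
        mem_inf_of_right (mem_principal_self _)
      filter_upwards [h1, h2] with z hz1 hz2
      have hz2' : 0 ≤ z.re := le_of_lt hz2
      set r := ‖z‖ with hr
      have hlog : Real.log (1 + r) ≤ 4 * r ^ (1 / 2 : ℝ) := by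
        have e1 := Real.log_le_rpow_div (x := 1 + r) (by linarith) (ε := 1 / 2) (by norm_num)
        have e2 : (1 + r) ^ (1 / 2 : ℝ) ≤ (4 * r) ^ (1 / 2 : ℝ) :=
          Real.rpow_le_rpow (by linarith) (by linarith) (by norm_num)
        have e3 : (4 * r) ^ (1 / 2 : ℝ) = 2 * r ^ (1 / 2 : ℝ) := by
          rw [Real.mul_rpow (by norm_num) (by linarith), ← Real.sqrt_eq_rpow 4,
            show (4 : ℝ) = 2 ^ 2 by norm_num, Real.sqrt_sq (by norm_num)]
        rw [e3] at e2
        linarith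
      have hs1 : 1 ≤ r ^ (1 / 2 : ℝ) := Real.one_le_rpow hz1 (by norm_num)
      have hmul : r * r ^ (1 / 2 : ℝ) = r ^ (3 / 2 : ℝ) := by
        rw [show (3 / 2 : ℝ) = 1 + 1 / 2 by norm_num, Real.rpow_add (by linarith), Real.rpow_one]
      have hnE : ‖E z‖ ≤ Real.exp (c * (4 + π) * r ^ (3 / 2 : ℝ)) := by
        rw [hEn]
        apply Real.exp_le_exp.2
        have e1 : -(z * Complex.log (1 + z)).re ≤ r * (Real.log (1 + r) + π) := by
          refine (neg_le_abs _).trans ((Complex.abs_re_le_norm _).trans ?_)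
          rw [norm_mul]
          exact mul_le_mul_of_nonneg_left (norm_log_one_add_le hz2') (norm_nonneg _)
        have e2 : r * (Real.log (1 + r) + π) ≤ r * ((4 + π) * r ^ (1 / 2 : ℝ)) := by
          apply mul_le_mul_of_nonneg_left _ (by linarith)
          nlinarith [Real.pi_pos]
        calc -c * (z * Complex.log (1 + z)).re = c * -(z * Complex.log (1 + z)).re := by ring
          _ ≤ c * (r * ((4 + π) * r ^ (1 / 2 : ℝ))) :=
            mul_le_mul_of_nonneg_left (e1.trans e2) hc0.le
          _ = _ := by rw [← hmul]; ring
      have hnG : ‖G z‖ ≤ K * Real.exp (a * r ^ (3 / 2 : ℝ)) := by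
        refine (hGK z hz2').trans ?_
        gcongr
        rw [← hmul]
        exact le_mul_of_one_le_right (by linarith) hs1
      rw [norm_smul, Real.norm_of_nonneg (Real.exp_pos _).le]
      calc ‖E z‖ * ‖G z‖ ≤ Real.exp (c * (4 + π) * r ^ (3 / 2 : ℝ)) *
            (K * Real.exp (a * r ^ (3 / 2 : ℝ))) := by gcongr
        _ = K * Real.exp ((a + c * (4 + π)) * r ^ (3 / 2 : ℝ)) := by
          rw [mul_left_comm, ← Real.exp_add]; ring_nf
    · intro n
      have hlim : Tendsto (fun x : ℝ => K * Real.exp (((n : ℝ) + a - c * Real.log (1 + x)) * x))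
          atTop (𝓝 0) := by
        rw [← mul_zero K]
        refine Tendsto.const_mul K (Real.tendsto_exp_atBot.comp ?_)
        refine Tendsto.atBot_mul_atTop₀ ?_ tendsto_id
        refine tendsto_atBot_add_const_left _ _ ?_
        refine tendsto_neg_atTop_atBot.comp (Tendsto.const_mul_atTop hc0 ?_)
        exact Real.tendsto_log_atTop.comp (tendsto_atTop_add_const_left _ _ tendsto_id)
      refine squeeze_zero' (Eventually.of_forall fun x => by positivity) ?_ hlim
      filter_upwards [eventually_ge_atTop 0] with x hx
      have e1 : ‖E x‖ = Real.exp (-c * (x * Real.log (1 + x))) := by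
        rw [hEn]
        congr 2
        rw [Complex.re_ofReal_mul, ← Complex.ofReal_one, ← Complex.ofReal_add, Complex.log_ofReal_re]
      have e2 : ‖G x‖ ≤ K * Real.exp (a * x) := by
        have := hGK x (by simpa using hx)
        rwa [Complex.norm_real, Real.norm_of_nonneg hx] at this
      calc Real.exp x ^ n * ‖E x • G x‖ = Real.exp (n * x) *
            (Real.exp (-c * (x * Real.log (1 + x))) * ‖G x‖) := by
              rw [norm_smul, e1, ← Real.exp_nat_mul]
        _ ≤ Real.exp (n * x) *
            (Real.exp (-c * (x * Real.log (1 + x))) * (K * Real.exp (a * x))) := by gcongr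
        _ = K * Real.exp (((n : ℝ) + a - c * Real.log (1 + x)) * x) := by
          rw [mul_left_comm, mul_left_comm _ K, mul_left_comm _ K, ← Real.exp_add, ← Real.exp_add]
          ring_nf
    · refine ⟨C, fun y => ?_⟩
      have e1 : ‖E (y * Complex.I)‖ ≤ Real.exp (δ * |y|) := by
        rw [hEn]
        apply Real.exp_le_exp.2
        have : ((y * Complex.I) * Complex.log (1 + y * Complex.I)).re =
            -(y * (1 + y * Complex.I).arg) := by
          simp [Complex.log_im]
        rw [this]
        calc -c * -(y * (1 + y * Complex.I).arg) = c * (y * (1 + y * Complex.I).arg) := by ring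
          _ ≤ c * (|y| * π) := by
            refine mul_le_mul_of_nonneg_left ((le_abs_self _).trans ?_) hc0.le
            rw [abs_mul]
            exact mul_le_mul_of_nonneg_left (Complex.abs_arg_le_pi _) (abs_nonneg _)
          _ = δ * |y| := by rw [hc]; field_simp
      rw [norm_smul]
      calc ‖E (y * Complex.I)‖ * ‖G (y * Complex.I)‖ ≤
            Real.exp (δ * |y|) * (C * Real.exp (-δ * |y|)) := by
              gcongr
              exact hC y
        _ = C := by rw [mul_left_comm, ← Real.exp_add]; simp
  intro z hz
  have h := hW hz
  simp only [Pi.zero_apply, smul_eq_mul] at h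
  exact (mul_eq_zero.1 h).resolve_left (Complex.exp_ne_zero _)

/-- **Carlson's theorem**. Dividing by `sin (π z)` leaves a function that decays like
`exp (-(π - a) |y|)` on the line `Re z = 1 / 2`. -/
theorem AnalyticOfTypeLT.eq_zero_of_natCast_eq_zero {φ : ℂ → ℂ} (hφ : AnalyticOfTypeLT π φ)
    (h0 : ∀ n : ℕ, 1 ≤ n → φ n = 0) {z : ℂ} (hz : z ∈ rightHalfPlane) : φ z = 0 := by
  obtain ⟨a, ha, haπ, K, hK, hφK⟩ := hφ.exists_nonneg Real.pi_pos
  obtain ⟨G, hGd, hGφ⟩ := exists_mul_sin_eq hφ.1.differentiableOn h0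
  have hGb := fun (z : ℂ) (hz : 1 / 2 ≤ z.re) => norm_le_of_mul_sin_eq ha hK hGd hGφ hφK hz
  have hpos : ∀ w : ℂ, 0 ≤ w.re → 1 / 2 ≤ (w + 1 / 2).re := fun w hw => by
    simp; linarith
  -- The half-plane is shifted by `1 / 2`: on the new boundary line the sine has no zeros.
  have hmem : ∀ w : ℂ, 0 ≤ w.re → w + 1 / 2 ∈ rightHalfPlane := fun w hw =>
    lt_of_lt_of_le (by norm_num) (hpos w hw)
  have hnorm : ∀ w : ℂ, ‖w + 1 / 2‖ ≤ ‖w‖ + 1 := fun w => by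
    refine (norm_add_le _ _).trans ?_
    gcongr
    norm_num
  have hzero : Set.EqOn (fun w => G (w + 1 / 2)) 0 {w | 0 ≤ w.re} := by
    refine eqOn_zero_of_exp_decay_on_imaginary_axis (a := a) (K := K * Real.exp (a * 4))
      (δ := π - a) (C := 2 * (K * Real.exp a)) ha (by positivity) (by linarith) ?_ ?_ ?_
    · apply DifferentiableOn.diffContOnCl
      rw [Complex.closure_setOfPred_lt_re]
      exact hGd.comp (by fun_prop) fun w hw => hmem w hw
    · intro w hw
      refine (hGb _ (hpos w hw)).trans ?_
      have h := mul_le_mul_of_nonneg_left (hnorm w) ha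
      rw [mul_assoc, ← Real.exp_add]
      gcongr
      linarith
    · intro y
      set w : ℂ := y * Complex.I + 1 / 2 with hw
      have hwP : w ∈ rightHalfPlane := hmem _ (by simp)
      have h1 : ‖Complex.sin (π * w)‖ = Real.cosh (π * y) := by
        rw [norm_sin_of_re_eq (n := 0) (by simp [hw])]
        simp [hw]
      have h2 : Real.exp (π * |y|) / 2 ≤ Real.cosh (π * y) := by
        rw [← Real.cosh_abs, abs_mul, abs_of_pos Real.pi_pos, Real.cosh_eq]
        have := Real.exp_pos (-(π * |y|))
        linarith
      have h3 : ‖w‖ ≤ |y| + 1 := by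
        have h := hnorm (y * Complex.I)
        rwa [norm_mul, Complex.norm_I, mul_one, Complex.norm_real, Real.norm_eq_abs] at h
      have h4 : ‖G w‖ * Real.cosh (π * y) ≤ K * Real.exp (a * (|y| + 1)) := by
        rw [← h1, ← norm_mul, hGφ w hwP]
        refine (hφK w hwP).trans ?_
        gcongr
      have h5 : ‖G w‖ * (Real.exp (π * |y|) / 2) ≤ K * Real.exp (a * (|y| + 1)) :=
        (mul_le_mul_of_nonneg_left h2 (norm_nonneg _)).trans h4
      calc ‖G w‖ = 2 * (‖G w‖ * (Real.exp (π * |y|) / 2)) * Real.exp (-(π * |y|)) := by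
            rw [Real.exp_neg]; field_simp
        _ ≤ 2 * (K * Real.exp (a * (|y| + 1))) * Real.exp (-(π * |y|)) := by gcongr
        _ = 2 * (K * Real.exp a) * Real.exp (-(π - a) * |y|) := by
          rw [show a * (|y| + 1) = a + a * |y| by ring, Real.exp_add,
            show -(π - a) * |y| = a * |y| + -(π * |y|) by ring, Real.exp_add]
          ring
  have hone : φ =ᶠ[𝓝 1] 0 := by
    have : {z : ℂ | 1 / 2 < z.re} ∈ 𝓝 (1 : ℂ) :=
      (isOpen_lt continuous_const Complex.continuous_re).mem_nhds (by simp; norm_num)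
    filter_upwards [this] with w hw
    have hw' : 1 / 2 < w.re := hw
    have hG0 : G w = 0 := by
      have := hzero (x := w - 1 / 2) (by simp; linarith)
      simpa using this
    have hwP : w ∈ rightHalfPlane := lt_trans (by norm_num) hw'
    simpa [hG0] using (hGφ w hwP).symm
  exact hφ.1.eqOn_zero_of_preconnected_of_eventuallyEq_zero convex_rightHalfPlane.isPreconnected
    (show (1 : ℂ) ∈ rightHalfPlane by simp [rightHalfPlane]) hone hz

/-! ### Periodic functions of type less than `2π` -/

/-- Removability of the singularity of the cusp function at `q = 0`, under the growth condition
`exp (b |Im z|)`, `b < 2π`, in place of boundedness. -/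
theorem tendsto_comap_im_atTop_of_periodic {F : ℂ → ℂ} {b C : ℝ} (hb : b < 2 * π)
    (hF : Differentiable ℂ F) (hper : Function.Periodic F 1)
    (hFC : ∀ z, ‖F z‖ ≤ C * Real.exp (b * |z.im|)) :
    ∃ l, Tendsto F (comap Complex.im atTop) (𝓝 l) := by
  have hper' : Function.Periodic F (1 : ℝ) := by simpa using hper
  set c := Function.Periodic.cuspFunction 1 F with hc
  have hev : ∀ᶠ q in 𝓝[≠] (0 : ℂ), DifferentiableAt ℂ c q :=
    Function.Periodic.eventually_differentiableAt_cuspFunction_nhds_ne_zero one_pos hper'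
      (Eventually.of_forall fun z => hF z)
  have hsmall : Tendsto (fun q : ℂ => q * c q) (𝓝[≠] 0) (𝓝 0) := by
    have h1 : Tendsto (fun z : ℂ => Function.Periodic.qParam 1 z * F z)
        (comap Complex.im atTop) (𝓝 0) := by
      rw [tendsto_zero_iff_norm_tendsto_zero]
      have h2 : Tendsto (fun y : ℝ => C * Real.exp (-(2 * π - b) * y)) atTop (𝓝 0) := by
        rw [← mul_zero C]
        refine Tendsto.const_mul C (Real.tendsto_exp_atBot.comp ?_)
        exact tendsto_id.const_mul_atTop_of_neg (by linarith)
      refine squeeze_zero' (Eventually.of_forall fun _ => norm_nonneg _) ?_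
        (h2.comp tendsto_comap)
      filter_upwards [tendsto_comap.eventually (eventually_ge_atTop (0 : ℝ))] with z hz
      rw [norm_mul, Function.Periodic.norm_qParam]
      have := hFC z
      rw [abs_of_nonneg hz] at this
      calc _ ≤ Real.exp (-2 * π * z.im / 1) * (C * Real.exp (b * z.im)) := by gcongr
        _ = _ := by
          rw [mul_left_comm, ← Real.exp_add]
          simp only [Function.comp]
          ring_nf
    refine (h1.comp (Function.Periodic.invQParam_tendsto one_pos)).congr' ?_
    filter_upwards [self_mem_nhdsWithin] with q hq
    simp only [Function.comp, hc]
    rw [Function.Periodic.qParam_right_inv one_ne_zero hq,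
      Function.Periodic.cuspFunction_eq_of_nonzero _ _ hq]
  have hlim := Complex.tendsto_limUnder_of_differentiable_on_punctured_nhds_of_isLittleO hev (by
    refine isLittleO_of_tendsto' ?_ ?_
    · filter_upwards [self_mem_nhdsWithin] with q hq h
      have : q ≠ 0 := hq
      simp [this] at h
    · have h3 : Tendsto (fun q : ℂ => q * c 0) (𝓝[≠] 0) (𝓝 0) := by
        have : Tendsto (fun q : ℂ => q * c 0) (𝓝 0) (𝓝 (0 * c 0)) :=
          tendsto_id.mul_const (c 0)
        rw [zero_mul] at this
        exact this.mono_left nhdsWithin_le_nhds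
      have h4 := hsmall.sub h3
      rw [sub_zero] at h4
      refine h4.congr fun q => ?_
      rw [sub_zero, div_inv_eq_mul]
      ring)
  refine ⟨_, (hlim.comp (Function.Periodic.qParam_tendsto one_pos)).congr fun z => ?_⟩
  exact Function.Periodic.eq_cuspFunction one_ne_zero hper' z

/-- An entire `1`-periodic function that is `O(exp (b |Im z|))` with `b < 2π` is constant: it is
bounded near both ends of the period strip, so Liouville's theorem applies. -/
theorem apply_eq_apply_of_periodic_of_type_lt {F : ℂ → ℂ} {b C : ℝ} (hb0 : 0 ≤ b)
    (hb : b < 2 * π) (hF : Differentiable ℂ F) (hper : Function.Periodic F 1)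
    (hFC : ∀ z, ‖F z‖ ≤ C * Real.exp (b * |z.im|)) (z w : ℂ) : F z = F w := by
  have bdd : ∀ F : ℂ → ℂ, Differentiable ℂ F → Function.Periodic F 1 →
      (∀ z, ‖F z‖ ≤ C * Real.exp (b * |z.im|)) → ∃ Y M : ℝ, ∀ z : ℂ, Y ≤ z.im → ‖F z‖ ≤ M := by
    intro F hF hper hFC
    obtain ⟨l, hl⟩ := tendsto_comap_im_atTop_of_periodic hb hF hper hFC
    have h := hl.norm.eventually (eventually_le_nhds (show ‖l‖ < ‖l‖ + 1 by linarith))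
    rw [eventually_comap] at h
    obtain ⟨Y, hY⟩ := eventually_atTop.1 h
    exact ⟨Y, ‖l‖ + 1, fun z hz => hY _ hz z rfl⟩
  obtain ⟨Y₁, M₁, h₁⟩ := bdd F hF hper hFC
  obtain ⟨Y₂, M₂, h₂⟩ := bdd (fun z => F (-z)) (hF.comp differentiable_neg)
    (fun z => by
      have := hper (-(z + 1))
      show F (-(z + 1)) = F (-z)
      rw [← this]; congr 1; ring)
    (fun z => by simpa using hFC (-z))
  have hC : 0 ≤ C := by
    have := (norm_nonneg _).trans (hFC 0)
    simpa using this
  refine hF.apply_eq_apply_of_bounded ?_ z w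
  rw [isBounded_iff_forall_norm_le]
  refine ⟨max (max M₁ M₂) (C * Real.exp (b * max |Y₁| |Y₂|)), ?_⟩
  rintro _ ⟨z, rfl⟩
  by_cases c1 : Y₁ ≤ z.im
  · exact (h₁ z c1).trans ((le_max_left _ _).trans (le_max_left _ _))
  by_cases c2 : Y₂ ≤ -z.im
  · have := h₂ (-z) (by simpa using c2)
    rw [neg_neg] at this
    exact this.trans ((le_max_right _ _).trans (le_max_left _ _))
  refine (hFC z).trans (le_trans ?_ (le_max_right _ _))
  gcongr
  push Not at c1 c2
  rw [abs_le]
  constructor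
  · linarith [le_max_right |Y₁| |Y₂|, le_abs_self Y₂]
  · linarith [le_max_left |Y₁| |Y₂|, le_abs_self Y₁]

/-- A `1`-periodic function of type less than `2π` on the right half-plane is constant. -/
theorem AnalyticOfTypeLT.eq_of_periodic {D : ℂ → ℂ} (hD : AnalyticOfTypeLT (2 * π) D)
    (hper : ∀ z ∈ rightHalfPlane, D (z + 1) = D z) {z : ℂ} (hz : z ∈ rightHalfPlane) :
    D z = D 1 := by
  obtain ⟨b, hb0, hb, K, hK, hDK⟩ := hD.exists_nonneg Real.two_pi_pos
  have hnat : ∀ (n : ℕ) (z : ℂ), 0 < z.re → D (z + n) = D z := by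
    intro n
    induction n with
    | zero => intro z _; simp
    | succ n ih =>
      intro z hz
      rw [Nat.cast_succ, ← add_assoc, hper _ ?_, ih z hz]
      show 0 < (z + n).re
      simp only [Complex.add_re, Complex.natCast_re]
      positivity
  -- The periodic extension to the whole plane: `z + N z` lies in the right half-plane.
  set N : ℂ → ℕ := fun z => ⌊|z.re|⌋₊ + 1 with hN
  have hNpos : ∀ z : ℂ, 0 < (z + N z).re := fun z => by
    have h1 := Nat.lt_floor_add_one |z.re|
    have h2 := neg_abs_le z.re
    simp only [hN, Complex.add_re, Complex.natCast_re]
    push_cast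
    linarith
  set F : ℂ → ℂ := fun z => D (z + N z) with hF
  have hFn : ∀ (z : ℂ) (n : ℕ), 0 < (z + n).re → F z = D (z + n) := by
    intro z n hn
    calc F z = D (z + N z + n) := (hnat n _ (hNpos z)).symm
      _ = D (z + n + N z) := by ring_nf
      _ = D (z + n) := hnat _ _ hn
  have hFD : ∀ z, 0 < z.re → F z = D z := fun z hz => by
    have := hFn z 0 (by simpa using hz)
    simpa using this
  have hFper : Function.Periodic F 1 := by
    intro z
    have h := hNpos (z + 1)
    rw [hFn z (N (z + 1) + 1) (by push_cast; convert h using 2; ring)]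
    simp only [hF]
    push_cast
    congr 1; ring
  have hFd : Differentiable ℂ F := by
    intro z
    have h := hNpos z
    have hopen : ∀ᶠ w : ℂ in 𝓝 z, 0 < (w + (N z : ℂ)).re := by
      have : Continuous fun w : ℂ => (w + N z).re := by fun_prop
      exact this.continuousAt.eventually (lt_mem_nhds h)
    have hd : DifferentiableAt ℂ (fun w => D (w + N z)) z :=
      (hD.1 _ h).differentiableAt.comp z (differentiableAt_id.add_const _)
    refine hd.congr_of_eventuallyEq ?_
    filter_upwards [hopen] with w hw using hFn w _ hw
  have hFC : ∀ z, ‖F z‖ ≤ K * Real.exp (b * 2) * Real.exp (b * |z.im|) := by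
    intro z
    -- The translate of `z` with real part in `[1, 2)`.
    set w : ℂ := z - ((⌊z.re⌋ - 1 : ℤ) : ℂ) with hw
    have h1 := Int.floor_le z.re
    have h2 := Int.lt_floor_add_one z.re
    have hre : w.re = z.re - ⌊z.re⌋ + 1 := by simp [hw, -Int.self_sub_floor]; ring
    have him : w.im = z.im := by simp [hw]
    have hFw : F z = F w := by
      have := hFper.sub_int_mul_eq (x := z) (⌊z.re⌋ - 1)
      rw [mul_one] at this
      exact this.symm
    have hwpos : 0 < w.re := by rw [hre]; linarith
    rw [hFw, hFD w hwpos]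
    refine (hDK w hwpos).trans ?_
    rw [mul_assoc, ← Real.exp_add, ← mul_add]
    gcongr
    refine (Complex.norm_le_abs_re_add_abs_im w).trans ?_
    rw [him, abs_of_pos hwpos]
    gcongr
    linarith
  rw [← hFD z hz, ← hFD 1 (by simp)]
  exact apply_eq_apply_of_periodic_of_type_lt hb0 hb hFd hFper hFC z 1

/-! ### Uniqueness of the Ramanujan sum -/

theorem AnalyticOfTypeLT.intervalIntegrable_one_two {τ : ℝ} {R : ℂ → ℂ}
    (hR : AnalyticOfTypeLT τ R) :
    IntervalIntegrable (fun t : ℝ => R t) MeasureTheory.volume 1 2 := by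
  apply ContinuousOn.intervalIntegrable
  refine hR.1.continuousOn.comp Complex.continuous_ofReal.continuousOn fun t ht => ?_
  rw [Set.uIcc_of_le (by norm_num)] at ht
  show 0 < (t : ℂ).re
  rw [Complex.ofReal_re]
  linarith [ht.1]

theorem HasRamanujanSum.unique {a : ℕ → ℂ} {S S' : ℂ} (h : HasRamanujanSum a S)
    (h' : HasRamanujanSum a S') : S = S' := by
  obtain ⟨f, R, hf, hfa, ⟨hR, hRf, hR0⟩, rfl⟩ := h
  obtain ⟨f', R', hf', hfa', ⟨hR', hRf', hR0'⟩, rfl⟩ := h'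
  have hff : ∀ z ∈ rightHalfPlane, f z - f' z = 0 := fun z hz =>
    (hf.sub hf').eq_zero_of_natCast_eq_zero (fun n hn => by simp [hfa n hn, hfa' n hn]) hz
  have hconst : ∀ z ∈ rightHalfPlane, R z - R' z = R 1 - R' 1 := fun z hz =>
    (hR.sub hR').eq_of_periodic (fun z hz => by
      have h1 := hRf z hz
      have h2 := hRf' z hz
      have h3 := hff z hz
      linear_combination h2 - h1 - h3) hz
  have hint : ∫ t in (1 : ℝ)..2, (R (t : ℂ) - R' (t : ℂ)) = R 1 - R' 1 := by
    rw [intervalIntegral.integral_congr (g := fun _ => R 1 - R' 1)]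
    · rw [intervalIntegral.integral_const]; norm_num
    · intro t ht
      rw [Set.uIcc_of_le (by norm_num)] at ht
      refine hconst t ?_
      show 0 < (t : ℂ).re
      rw [Complex.ofReal_re]
      linarith [ht.1]
  rw [intervalIntegral.integral_sub hR.intervalIntegrable_one_two hR'.intervalIntegrable_one_two,
    hR0, hR0', sub_zero] at hint
  exact (sub_eq_zero.1 hint.symm)

theorem HasRamanujanSum.ramanujanSum_eq {a : ℕ → ℂ} {S : ℂ} (h : HasRamanujanSum a S) :
    ramanujanSum a = S := by
  have hex : ∃ S, HasRamanujanSum a S := ⟨S, h⟩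
  rw [ramanujanSum, dif_pos hex]
  exact hex.choose_spec.unique h

/-! ### The harmonic numbers at complex arguments -/

/-- The interpolation `x ↦ ψ (x + 1) + γ` of the harmonic numbers, as the series
`∑ n ≥ 1, (1 / n - 1 / (n + x))`; the summation index is shifted to start at `0`. -/
noncomputable def complexHarmonic (x : ℂ) : ℂ :=
  ∑' n : ℕ, (1 / ((n : ℂ) + 1) - 1 / ((n : ℂ) + 1 + x))

theorem natCast_add_one_add_ne_zero (n : ℕ) {x : ℂ} (hx : -1 / 2 < x.re) :
    (n : ℂ) + 1 + x ≠ 0 := by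
  intro h
  have := congrArg Complex.re h
  simp only [Complex.add_re, Complex.natCast_re, Complex.one_re, Complex.zero_re] at this
  have hn : (0 : ℝ) ≤ n := n.cast_nonneg
  linarith

theorem norm_one_div_sub_one_div_le (n : ℕ) {x : ℂ} (hx : -1 / 2 < x.re) :
    ‖1 / ((n : ℂ) + 1) - 1 / ((n : ℂ) + 1 + x)‖ ≤ 2 / ((n : ℝ) + 1) ^ 2 * ‖x‖ := by
  have h0 := natCast_add_one_add_ne_zero n hx
  have h1 : ((n : ℝ) + 1) / 2 ≤ ‖(n : ℂ) + 1 + x‖ := by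
    refine le_trans ?_ (Complex.re_le_norm _)
    simp only [Complex.add_re, Complex.natCast_re, Complex.one_re]
    have hn : (0 : ℝ) ≤ n := n.cast_nonneg
    linarith
  have h2 : ‖(n : ℂ) + 1‖ = (n : ℝ) + 1 := by
    rw [← Nat.cast_add_one, Complex.norm_natCast]; push_cast; ring
  have h3 : 1 / ((n : ℂ) + 1) - 1 / ((n : ℂ) + 1 + x) = x / (((n : ℂ) + 1) * ((n : ℂ) + 1 + x)) := by
    field_simp [Nat.cast_add_one_ne_zero (R := ℂ) n, h0]
    ring
  rw [h3, norm_div, norm_mul, h2]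
  calc ‖x‖ / (((n : ℝ) + 1) * ‖(n : ℂ) + 1 + x‖) ≤ ‖x‖ / (((n : ℝ) + 1) * (((n : ℝ) + 1) / 2)) := by
        gcongr
    _ = _ := by field_simp

theorem summable_two_div_sq : Summable fun n : ℕ => 2 / ((n : ℝ) + 1) ^ 2 := by
  have := (summable_nat_add_iff (f := fun n : ℕ => 1 / (n : ℝ) ^ 2) 1).2
    (Real.summable_one_div_nat_pow.2 one_lt_two)
  refine (this.mul_left 2).congr fun n => ?_
  push_cast
  ring

theorem summable_complexHarmonic {x : ℂ} (hx : -1 / 2 < x.re) :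
    Summable fun n : ℕ => 1 / ((n : ℂ) + 1) - 1 / ((n : ℂ) + 1 + x) :=
  Summable.of_norm_bounded (summable_two_div_sq.mul_right ‖x‖) fun n =>
    norm_one_div_sub_one_div_le n hx

/-- Linear growth; this crude bound is enough for subexponential growth. -/
theorem norm_complexHarmonic_le {x : ℂ} (hx : -1 / 2 < x.re) :
    ‖complexHarmonic x‖ ≤ (∑' n : ℕ, 2 / ((n : ℝ) + 1) ^ 2) * ‖x‖ := by
  rw [← tsum_mul_right]
  exact tsum_of_norm_bounded (summable_two_div_sq.mul_right ‖x‖).hasSum fun n =>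
    norm_one_div_sub_one_div_le n hx

theorem differentiableAt_complexHarmonic {x : ℂ} (hx : -1 / 2 < x.re) :
    DifferentiableAt ℂ complexHarmonic x := by
  set U : Set ℂ := {z | -1 / 2 < z.re} ∩ Metric.ball 0 (‖x‖ + 1) with hU
  have hUo : IsOpen U :=
    (isOpen_lt continuous_const Complex.continuous_re).inter Metric.isOpen_ball
  have hxU : x ∈ U := ⟨hx, by simp⟩
  have hd : DifferentiableOn ℂ complexHarmonic U := by
    refine Complex.differentiableOn_tsum_of_summable_norm
      (summable_two_div_sq.mul_right (‖x‖ + 1)) (fun n z hz => ?_) hUo (fun n z hz => ?_)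
    · have := natCast_add_one_add_ne_zero n hz.1
      exact (DifferentiableAt.sub (differentiableAt_const _) ((differentiableAt_const _).div
        (differentiableAt_id.const_add _) this)).differentiableWithinAt
    · refine (norm_one_div_sub_one_div_le n hz.1).trans ?_
      gcongr
      exact (mem_ball_zero_iff.1 hz.2).le
  exact hd.differentiableAt (hUo.mem_nhds hxU)

theorem complexHarmonic_add_one {x : ℂ} (hx : -1 / 2 < x.re) :
    complexHarmonic (x + 1) = complexHarmonic x + 1 / (x + 1) := by
  have hx1 : -1 / 2 < (x + 1).re := by simp; linarith
  have h1 := ((summable_complexHarmonic hx1).hasSum.sub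
    (summable_complexHarmonic hx).hasSum).tendsto_sum_nat
  have h2 : ∀ N : ℕ, ∑ n ∈ Finset.range N, ((1 / ((n : ℂ) + 1) - 1 / ((n : ℂ) + 1 + (x + 1))) -
      (1 / ((n : ℂ) + 1) - 1 / ((n : ℂ) + 1 + x))) = 1 / (x + 1) - 1 / ((N : ℂ) + 1 + x) := by
    intro N
    have := Finset.sum_range_sub' (fun n : ℕ => 1 / ((n : ℂ) + 1 + x)) N
    simp only [Nat.cast_zero, zero_add] at this
    rw [add_comm x 1, ← this]
    refine Finset.sum_congr rfl fun n _ => ?_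
    push_cast
    ring_nf
  have h3 : Tendsto (fun N : ℕ => 1 / (x + 1) - 1 / ((N : ℂ) + 1 + x)) atTop
      (𝓝 (1 / (x + 1) - 0)) := by
    refine tendsto_const_nhds.sub ?_
    simp only [one_div, add_assoc]
    refine tendsto_inv₀_cobounded.comp ?_
    exact tendsto_add_const_cobounded _ |>.comp tendsto_natCast_atTop_cobounded
  have h4 := tendsto_nhds_unique (h1.congr h2) h3
  rw [sub_zero] at h4
  rw [← h4, complexHarmonic, complexHarmonic]
  ring

theorem complexHarmonic_natCast (n : ℕ) : complexHarmonic n = (harmonic n : ℂ) := by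
  induction n with
  | zero => simp [complexHarmonic]
  | succ n ih =>
    have : -1 / 2 < (n : ℂ).re := by
      have hn : (0 : ℝ) ≤ n := n.cast_nonneg
      simp only [Complex.natCast_re]; linarith
    rw [Nat.cast_succ, complexHarmonic_add_one this, ih, harmonic_succ]
    push_cast
    ring

theorem continuousOn_complexHarmonic_ofReal :
    ContinuousOn (fun y : ℝ => complexHarmonic y) (Set.uIcc 0 1) := by
  intro y hy
  rw [Set.uIcc_of_le zero_le_one] at hy
  have : -1 / 2 < (y : ℂ).re := by rw [Complex.ofReal_re]; linarith [hy.1]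
  exact ((differentiableAt_complexHarmonic this).continuousAt.comp
    Complex.continuous_ofReal.continuousAt).continuousWithinAt

/-- Termwise integration of the series against a continuous weight. -/
theorem hasSum_integral_mul_complexHarmonic {g : ℝ → ℂ} (hg : Continuous g) :
    HasSum (fun n : ℕ => ∫ y in (0 : ℝ)..1, g y * (1 / ((n : ℂ) + 1) - 1 / ((n : ℂ) + 1 + y)))
      (∫ y in (0 : ℝ)..1, g y * complexHarmonic y) := by
  obtain ⟨M, hM⟩ := (isCompact_Icc (a := (0 : ℝ)) (b := 1)).exists_bound_of_continuousOn
    hg.continuousOn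
  have hre : ∀ y : ℝ, y ∈ Set.Icc (0 : ℝ) 1 → -1 / 2 < (y : ℂ).re := fun y hy => by
    rw [Complex.ofReal_re]; linarith [hy.1]
  have hsub : Set.uIoc (0 : ℝ) 1 ⊆ Set.Icc 0 1 := by
    rw [Set.uIoc_of_le zero_le_one]; exact Set.Ioc_subset_Icc_self
  refine intervalIntegral.hasSum_integral_of_dominated_convergence
    (fun n _ => 2 / ((n : ℝ) + 1) ^ 2 * M) (fun n => ?_) (fun n => ?_) ?_ ?_ ?_
  · refine ContinuousOn.aestronglyMeasurable (fun y hy => ?_) measurableSet_uIoc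
    have h0 := natCast_add_one_add_ne_zero n (hre y (hsub hy))
    have : ContinuousAt (fun y : ℝ => (n : ℂ) + 1 + y) y := by fun_prop
    exact (hg.continuousAt.mul (continuousAt_const.sub
      (continuousAt_const.div this h0))).continuousWithinAt
  · refine Eventually.of_forall fun y hy => ?_
    have hy' := hsub hy
    rw [norm_mul, mul_comm]
    refine mul_le_mul ?_ (hM y hy') (norm_nonneg _) (by positivity)
    refine (norm_one_div_sub_one_div_le n (hre y hy')).trans ?_
    refine mul_le_of_le_one_right (by positivity) ?_
    rw [Complex.norm_real, Real.norm_of_nonneg hy'.1]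
    exact hy'.2
  · exact Eventually.of_forall fun y _ => summable_two_div_sq.mul_right M
  · exact intervalIntegrable_const
  · refine Eventually.of_forall fun y hy => ?_
    exact (summable_complexHarmonic (hre y (hsub hy))).hasSum.mul_left (g y)

theorem integral_complexHarmonic :
    ∫ y in (0 : ℝ)..1, complexHarmonic y = (Real.eulerMascheroniConstant : ℂ) := by
  have h := (hasSum_integral_mul_complexHarmonic (g := fun _ => 1) continuous_const).tendsto_sum_nat
  simp only [one_mul] at h
  have h1 : ∀ n : ℕ, ∫ y in (0 : ℝ)..1, (1 / ((n : ℂ) + 1) - 1 / ((n : ℂ) + 1 + y)) =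
      ((1 / ((n : ℝ) + 1) - (Real.log ((n + 1 : ℕ) + 1) - Real.log ((n : ℝ) + 1)) : ℝ) : ℂ) := by
    intro n
    have e1 : ∀ y : ℝ, (1 / ((n : ℂ) + 1) - 1 / ((n : ℂ) + 1 + y)) =
        ((1 / ((n : ℝ) + 1) - 1 / ((n : ℝ) + 1 + y) : ℝ) : ℂ) := fun y => by push_cast; ring
    simp only [e1]
    rw [intervalIntegral.integral_ofReal]
    congr 1
    have hn : (0 : ℝ) ≤ n := n.cast_nonneg
    have hd : ∀ y ∈ Set.uIcc (0 : ℝ) 1, HasDerivAt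
        (fun y : ℝ => y * (1 / ((n : ℝ) + 1)) - Real.log ((n : ℝ) + 1 + y))
        (1 / ((n : ℝ) + 1) - 1 / ((n : ℝ) + 1 + y)) y := by
      intro y hy
      rw [Set.uIcc_of_le zero_le_one] at hy
      have h0 : (n : ℝ) + 1 + y ≠ 0 := by linarith [hy.1]
      have d1 := (hasDerivAt_id y).mul_const (1 / ((n : ℝ) + 1))
      have d2 := ((hasDerivAt_id y).const_add ((n : ℝ) + 1)).log h0
      simpa using d1.fun_sub d2
    rw [intervalIntegral.integral_eq_sub_of_hasDerivAt hd]
    · push_cast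
      simp
      ring_nf
    · apply ContinuousOn.intervalIntegrable
      intro y hy
      rw [Set.uIcc_of_le zero_le_one] at hy
      have h0 : (n : ℝ) + 1 + y ≠ 0 := by linarith [hy.1]
      have : ContinuousAt (fun y : ℝ => (n : ℝ) + 1 + y) y := by fun_prop
      exact (continuousAt_const.sub (continuousAt_const.div this h0)).continuousWithinAt
  have h2 : ∀ N : ℕ, ∑ n ∈ Finset.range N,
      ∫ y in (0 : ℝ)..1, (1 / ((n : ℂ) + 1) - 1 / ((n : ℂ) + 1 + y)) =
      (((harmonic N : ℝ) - Real.log ((N : ℝ) + 1) : ℝ) : ℂ) := by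
    intro N
    simp only [h1]
    rw [← Complex.ofReal_sum, Finset.sum_sub_distrib,
      Finset.sum_range_sub (fun n : ℕ => Real.log ((n : ℝ) + 1))]
    simp [harmonic]
  refine tendsto_nhds_unique (h.congr h2) ?_
  exact (Complex.continuous_ofReal.tendsto _).comp Real.tendsto_eulerMascheroniSeq

open Polynomial

/-! ### Subexponential growth -/

/-- `f` is `O(exp (ε |x|))` on the right half-plane for every `ε > 0`. -/
def SubexponentialGrowth (f : ℂ → ℂ) : Prop :=
  ∀ ε > 0, ∃ K > 0, ∀ x ∈ rightHalfPlane, ‖f x‖ ≤ K * Real.exp (ε * ‖x‖)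

namespace SubexponentialGrowth

theorem of_linear_bound {f : ℂ → ℂ} {C : ℝ} (hf : ∀ x ∈ rightHalfPlane, ‖f x‖ ≤ C * (‖x‖ + 1)) :
    SubexponentialGrowth f := by
  intro ε hε
  refine ⟨(|C| + 1) * (1 / ε + 1), by positivity, fun x hx => (hf x hx).trans ?_⟩
  have h1 : ε * ‖x‖ + 1 ≤ Real.exp (ε * ‖x‖) := Real.add_one_le_exp _
  have h2 : ‖x‖ + 1 ≤ (1 / ε + 1) * Real.exp (ε * ‖x‖) := by
    have e1 : 0 ≤ ε * ‖x‖ := by positivity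
    calc ‖x‖ + 1 ≤ (1 / ε + 1) * (ε * ‖x‖ + 1) := by
          have : (1 / ε + 1) * (ε * ‖x‖ + 1) = ‖x‖ + 1 + (1 / ε + ε * ‖x‖) := by
            field_simp; ring
          rw [this]
          have : 0 < 1 / ε := by positivity
          linarith
      _ ≤ _ := by gcongr
  have h3 : C ≤ |C| + 1 := (le_abs_self C).trans (by linarith)
  rw [mul_assoc]
  calc C * (‖x‖ + 1) ≤ (|C| + 1) * (‖x‖ + 1) := by gcongr
    _ ≤ _ := by gcongr

theorem add {f g : ℂ → ℂ} (hf : SubexponentialGrowth f) (hg : SubexponentialGrowth g) :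
    SubexponentialGrowth (fun x => f x + g x) := by
  intro ε hε
  obtain ⟨K, hK, hfK⟩ := hf ε hε
  obtain ⟨L, hL, hgL⟩ := hg ε hε
  refine ⟨K + L, by positivity, fun x hx => (norm_add_le _ _).trans ?_⟩
  rw [add_mul]
  exact add_le_add (hfK x hx) (hgL x hx)

theorem mul {f g : ℂ → ℂ} (hf : SubexponentialGrowth f) (hg : SubexponentialGrowth g) :
    SubexponentialGrowth (fun x => f x * g x) := by
  intro ε hε
  obtain ⟨K, hK, hfK⟩ := hf (ε / 2) (by positivity)
  obtain ⟨L, hL, hgL⟩ := hg (ε / 2) (by positivity)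
  refine ⟨K * L, by positivity, fun x hx => ?_⟩
  rw [norm_mul]
  calc ‖f x‖ * ‖g x‖ ≤ (K * Real.exp (ε / 2 * ‖x‖)) * (L * Real.exp (ε / 2 * ‖x‖)) := by
        gcongr
        · exact hfK x hx
        · exact hgL x hx
    _ = K * L * Real.exp (ε * ‖x‖) := by
        rw [mul_mul_mul_comm, ← Real.exp_add]; ring_nf

theorem const (c : ℂ) : SubexponentialGrowth (fun _ => c) :=
  of_linear_bound (C := ‖c‖) fun x _ => le_mul_of_one_le_right (norm_nonneg c)
    (by linarith [norm_nonneg x])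

theorem aeval (p : ℚ[X]) : SubexponentialGrowth (fun x => Polynomial.aeval x p) := by
  have hid : SubexponentialGrowth (fun x => x) :=
    of_linear_bound (C := 1) fun x _ => by linarith
  induction p using Polynomial.induction_on with
  | C a => simpa using const (a : ℂ)
  | add p q hp hq => simpa using hp.add hq
  | monomial n a h =>
    have := h.mul hid
    simpa [pow_succ, mul_assoc] using this

theorem complexHarmonic : SubexponentialGrowth complexHarmonic := by
  refine of_linear_bound (C := ∑' n : ℕ, 2 / ((n : ℝ) + 1) ^ 2) fun x hx => ?_
  have hx' : 0 < x.re := hx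
  refine (norm_complexHarmonic_le (by linarith)).trans ?_
  gcongr
  linarith

theorem analyticOfTypeLT {f : ℂ → ℂ} (hf : SubexponentialGrowth f)
    (hd : DifferentiableOn ℂ f rightHalfPlane) {τ : ℝ} (hτ : 0 < τ) : AnalyticOfTypeLT τ f :=
  ⟨hd.analyticOnNhd isOpen_rightHalfPlane, τ / 2, by linarith, hf (τ / 2) (by positivity)⟩

end SubexponentialGrowth

/-! ### Rational polynomials: antidifferences and integrals -/

theorem exists_comp_one_add_X_sub_eq (r : ℚ[X]) : ∃ Q : ℚ[X], Q.comp (1 + X) - Q = r := by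
  induction r using Polynomial.induction_on' with
  | add p q hp hq =>
    obtain ⟨P, rfl⟩ := hp
    obtain ⟨Q, rfl⟩ := hq
    exact ⟨P + Q, by rw [add_comp]; ring⟩
  | monomial n a =>
    refine ⟨C (a / (n + 1)) * Polynomial.bernoulli (n + 1), ?_⟩
    rw [mul_comp, C_comp, bernoulli_comp_one_add_X, mul_add, add_sub_cancel_left,
      Nat.add_sub_cancel, nsmul_eq_mul, ← C_eq_natCast, ← mul_assoc, ← C_mul, Nat.cast_succ,
      div_mul_cancel₀ a (Nat.cast_add_one_ne_zero n), C_mul_X_pow_eq_monomial]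

theorem continuous_aeval_ofReal (p : ℚ[X]) : Continuous fun y : ℝ => aeval (y : ℂ) p :=
  p.continuous_aeval.comp Complex.continuous_ofReal

theorem exists_rat_integral_eq (p : ℚ[X]) :
    ∃ r : ℚ, ∫ y in (0 : ℝ)..1, aeval (y : ℂ) p = (r : ℂ) := by
  induction p using Polynomial.induction_on' with
  | add p q hp hq =>
    obtain ⟨r, hr⟩ := hp
    obtain ⟨s, hs⟩ := hq
    refine ⟨r + s, ?_⟩
    simp only [map_add]
    rw [intervalIntegral.integral_add ((continuous_aeval_ofReal p).intervalIntegrable _ _)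
      ((continuous_aeval_ofReal q).intervalIntegrable _ _), hr, hs]
    push_cast; rfl
  | monomial n a =>
    refine ⟨a / (n + 1), ?_⟩
    have h : ∀ y : ℝ, aeval (y : ℂ) (monomial n a) = (a : ℂ) * ((y ^ n : ℝ) : ℂ) := fun y => by
      rw [aeval_monomial]; push_cast; rfl
    simp only [h]
    rw [intervalIntegral.integral_const_mul, intervalIntegral.integral_ofReal, integral_pow]
    push_cast
    simp
    ring

/-! ### The Ramanujan sum of `p(n) H_n` -/

/-- Summation by parts: if `q (x + 1) - q x = p x` and `x (Q (x + 1) - Q x) = q x - q 0`, then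
`-(q x - q 0) H x + Q (x + 1) + c` solves the difference equation for `p x * H x`. -/
theorem hasRamanujanSum_aeval_mul_harmonic {p q Q : ℚ[X]} {q₀ : ℚ}
    (hq : ∀ x : ℂ, aeval (x + 1) q - aeval x q = aeval x p)
    (hQ : ∀ x : ℂ, x * (aeval (x + 1) Q - aeval x Q) = aeval x q - q₀) :
    HasRamanujanSum (fun n => aeval (n : ℂ) p * (harmonic n : ℂ))
      (aeval (1 : ℂ) Q - (∫ y in (0 : ℝ)..1, aeval ((y : ℂ) + 1) Q) -
        q₀ * (Real.eulerMascheroniConstant : ℂ) +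
        ∫ y in (0 : ℝ)..1, aeval ((y : ℂ) + 1) q * complexHarmonic y) := by
  -- The constant that normalizes `∫ t in 1..2, R t` to `0`.
  set c : ℂ := -(∫ y in (0 : ℝ)..1, aeval ((y : ℂ) + 1) Q) -
        q₀ * (Real.eulerMascheroniConstant : ℂ) +
        ∫ y in (0 : ℝ)..1, aeval ((y : ℂ) + 1) q * complexHarmonic y with hc
  have hshift : ∀ (r : ℚ[X]) (x : ℂ), aeval (x + 1) r = aeval x (r.comp (X + 1)) := fun r x => by
    rw [aeval_comp]; simp
  have hre : ∀ x ∈ rightHalfPlane, -1 / 2 < x.re := fun x hx => by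
    have : 0 < x.re := hx
    linarith
  have hHd : DifferentiableOn ℂ complexHarmonic rightHalfPlane := fun x hx =>
    (differentiableAt_complexHarmonic (hre x hx)).differentiableWithinAt
  set R : ℂ → ℂ := fun x =>
    aeval x (C q₀ - q) * complexHarmonic x + (aeval x (Q.comp (X + 1)) + c) with hR
  have hRx : ∀ x, R x = (q₀ - aeval x q) * complexHarmonic x + (aeval (x + 1) Q + c) := fun x => by
    simp only [hR, map_sub, aeval_C, hshift]
    rfl
  refine ⟨fun x => aeval x p * complexHarmonic x, R,
    ((SubexponentialGrowth.aeval p).mul .complexHarmonic).analyticOfTypeLT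
      (p.differentiable_aeval.differentiableOn.mul hHd) Real.pi_pos,
    fun n _ => by simp only [complexHarmonic_natCast], ⟨?_, ?_, ?_⟩, ?_⟩
  · exact (((SubexponentialGrowth.aeval _).mul .complexHarmonic).add
      ((SubexponentialGrowth.aeval _).add (.const c))).analyticOfTypeLT
      (((Polynomial.differentiable_aeval _).differentiableOn.mul hHd).add
        ((Polynomial.differentiable_aeval _).differentiableOn.add_const _)) Real.two_pi_pos
  · intro x hx
    have h1 : x + 1 ≠ 0 := fun h => by
      have h2 : 0 < x.re := hx
      have := congrArg Complex.re h
      simp at this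
      linarith
    have h2 := hQ (x + 1)
    have h3 : aeval (x + 1 + 1) Q - aeval (x + 1) Q = (aeval (x + 1) q - q₀) * (1 / (x + 1)) := by
      rw [← h2]; field_simp
    simp only [hRx, complexHarmonic_add_one (hre x hx), ← hq]
    linear_combination -h3
  · have e1 : ∫ t in (1 : ℝ)..2, R (t : ℂ) = ∫ y in (0 : ℝ)..1, R ((y + 1 : ℝ) : ℂ) := by
      rw [intervalIntegral.integral_comp_add_right (fun t : ℝ => R (t : ℂ))]
      norm_num
    have e2 : ∀ y ∈ Set.uIcc (0 : ℝ) 1, R ((y + 1 : ℝ) : ℂ) =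
        q₀ * complexHarmonic y - aeval ((y : ℂ) + 1) q * complexHarmonic y +
          (aeval ((y : ℂ) + 1) Q + c) := by
      intro y hy
      rw [Set.uIcc_of_le zero_le_one] at hy
      have h1 : (y : ℂ) + 1 ≠ 0 := by
        have : y + 1 ≠ 0 := by linarith [hy.1]
        exact_mod_cast this
      have h2 := hQ ((y : ℂ) + 1)
      have h3 : aeval ((y : ℂ) + 1 + 1) Q - aeval ((y : ℂ) + 1) Q =
          (aeval ((y : ℂ) + 1) q - q₀) * (1 / ((y : ℂ) + 1)) := by
        rw [← h2]; field_simp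
      have hy' : -1 / 2 < (y : ℂ).re := by rw [Complex.ofReal_re]; linarith [hy.1]
      push_cast
      rw [hRx, complexHarmonic_add_one hy']
      linear_combination h3
    have i1 : IntervalIntegrable (fun y : ℝ => complexHarmonic y) MeasureTheory.volume 0 1 :=
      continuousOn_complexHarmonic_ofReal.intervalIntegrable
    have cont : ∀ r : ℚ[X], Continuous fun y : ℝ => aeval ((y : ℂ) + 1) r := fun r => by
      simp only [hshift]; exact continuous_aeval_ofReal _
    have i2 : IntervalIntegrable (fun y : ℝ => aeval ((y : ℂ) + 1) q * complexHarmonic y)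
        MeasureTheory.volume 0 1 :=
      ((cont q).continuousOn.mul continuousOn_complexHarmonic_ofReal).intervalIntegrable
    have i3 : IntervalIntegrable (fun y : ℝ => aeval ((y : ℂ) + 1) Q) MeasureTheory.volume 0 1 :=
      (cont Q).intervalIntegrable _ _
    rw [e1, intervalIntegral.integral_congr e2,
      intervalIntegral.integral_add ((i1.const_mul _).sub i2) (i3.add intervalIntegrable_const),
      intervalIntegral.integral_sub (i1.const_mul _) i2,
      intervalIntegral.integral_add i3 intervalIntegrable_const,
      intervalIntegral.integral_const_mul, integral_complexHarmonic,
      intervalIntegral.integral_const, hc]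
    simp only [sub_zero, one_smul]
    ring
  · have h1 := hQ 1
    rw [one_mul] at h1
    have h2 := complexHarmonic_natCast 1
    rw [hRx]
    simp only [Nat.cast_one, harmonic_succ, harmonic_zero, zero_add] at h2
    rw [h2]
    push_cast
    linear_combination h1

/-- The auxiliary polynomial of `hasRamanujanSum_aeval_mul_harmonic` always exists, and contributes
only a rational number to the sum. -/
theorem exists_rat_hasRamanujanSum {p q : ℚ[X]}
    (hq : ∀ x : ℂ, aeval (x + 1) q - aeval x q = aeval x p) :
    ∃ r : ℚ, HasRamanujanSum (fun n => aeval (n : ℂ) p * (harmonic n : ℂ))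
      (r - (q.eval 0 : ℚ) * (Real.eulerMascheroniConstant : ℂ) +
        ∫ y in (0 : ℝ)..1, aeval ((y : ℂ) + 1) q * complexHarmonic y) := by
  obtain ⟨Q, hQ⟩ := exists_comp_one_add_X_sub_eq q.divX
  have hQx : ∀ x : ℂ, x * (aeval (x + 1) Q - aeval x Q) = aeval x q - (q.eval 0 : ℚ) := by
    intro x
    have h1 : aeval (x + 1) Q - aeval x Q = aeval x q.divX := by
      rw [← hQ, map_sub, aeval_comp]; simp [add_comm]
    have h2 := congrArg (aeval x) q.divX_mul_X_add
    simp only [map_add, map_mul, aeval_X, aeval_C, coeff_zero_eq_eval_zero] at h2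
    rw [h1, ← h2]
    simp [mul_comm]
  obtain ⟨s, hs⟩ := exists_rat_integral_eq (Q.comp (X + 1))
  have hs' : ∫ y in (0 : ℝ)..1, aeval ((y : ℂ) + 1) Q = (s : ℂ) := by
    rw [← hs]; simp only [aeval_comp]; simp
  have h1 : aeval (1 : ℂ) Q = ((Q.eval 1 : ℚ) : ℂ) := by
    have := aeval_algebraMap_apply ℂ (1 : ℚ) Q
    simpa using this
  refine ⟨Q.eval 1 - s, ?_⟩
  have := hasRamanujanSum_aeval_mul_harmonic hq hQx
  rw [hs', h1] at this
  push_cast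
  exact this

/-! ### Euler–Maclaurin formula for the zeta function -/

/-- The contribution of the interval `[n + 1, n + 2]` to the Euler–Maclaurin remainder
`∫ B_m({t}) t ^ (-(s + m)) dt` over `t ≥ 1`. -/
noncomputable def eulerMaclaurinTerm (m n : ℕ) (s : ℂ) : ℂ :=
  ∫ y in (0 : ℝ)..1, aeval (y : ℂ) (Polynomial.bernoulli m) * ((n : ℂ) + 1 + y) ^ (-(s + m))

/-- The Euler–Maclaurin remainder `∫ B_m({t}) t ^ (-(s + m)) dt` over `t ≥ 1`. -/
noncomputable def eulerMaclaurinIntegral (m : ℕ) (s : ℂ) : ℂ :=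
  ∑' n : ℕ, eulerMaclaurinTerm m n s

theorem natCast_add_one_add_ofReal (n : ℕ) (y : ℝ) :
    (n : ℂ) + 1 + y = ((n + 1 + y : ℝ) : ℂ) := by push_cast; rfl

theorem natCast_add_one_add_mem_slitPlane (n : ℕ) {y : ℝ} (hy : 0 ≤ y) :
    (n : ℂ) + 1 + y ∈ Complex.slitPlane := by
  rw [natCast_add_one_add_ofReal, Complex.ofReal_mem_slitPlane]
  positivity

theorem hasDerivAt_natCast_add_one_add_cpow (n : ℕ) (w : ℂ) {y : ℝ} (hy : 0 ≤ y) :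
    HasDerivAt (fun y : ℝ => ((n : ℂ) + 1 + y) ^ w) (w * ((n : ℂ) + 1 + y) ^ (w - 1)) y := by
  have h := ((hasDerivAt_id (y : ℂ)).const_add ((n : ℂ) + 1)).cpow_const (c := w)
    (natCast_add_one_add_mem_slitPlane n hy)
  simpa using h.comp_ofReal

theorem continuousOn_natCast_add_one_add_cpow (n : ℕ) (w : ℂ) :
    ContinuousOn (fun y : ℝ => ((n : ℂ) + 1 + y) ^ w) (Set.uIcc 0 1) := by
  intro y hy
  rw [Set.uIcc_of_le zero_le_one] at hy
  exact (hasDerivAt_natCast_add_one_add_cpow n w hy.1).continuousAt.continuousWithinAt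

theorem intervalIntegrable_aeval_mul_cpow (p : ℚ[X]) (n : ℕ) (w : ℂ) :
    IntervalIntegrable (fun y : ℝ => aeval (y : ℂ) p * ((n : ℂ) + 1 + y) ^ w)
      MeasureTheory.volume 0 1 :=
  ((continuous_aeval_ofReal p).continuousOn.mul
    (continuousOn_natCast_add_one_add_cpow n w)).intervalIntegrable

theorem aeval_one_eq (p : ℚ[X]) : aeval (1 : ℂ) p = ((p.eval 1 : ℚ) : ℂ) := by
  simpa using aeval_algebraMap_apply ℂ (1 : ℚ) p

theorem aeval_zero_eq (p : ℚ[X]) : aeval (0 : ℂ) p = ((p.eval 0 : ℚ) : ℂ) := by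
  simpa using aeval_algebraMap_apply ℂ (0 : ℚ) p

theorem hasDerivAt_aeval_bernoulli (m : ℕ) (y : ℝ) :
    HasDerivAt (fun y : ℝ => aeval (y : ℂ) (Polynomial.bernoulli (m + 1)))
      ((m + 1) * aeval (y : ℂ) (Polynomial.bernoulli m)) y := by
  have h := (Polynomial.hasDerivAt_aeval (Polynomial.bernoulli (m + 1)) (y : ℂ)).comp_ofReal
  rw [derivative_bernoulli_add_one] at h
  simpa using h

/-- Integration by parts on one interval. -/
theorem eulerMaclaurinTerm_succ (m n : ℕ) (s : ℂ) :
    (s + m) * eulerMaclaurinTerm (m + 1) n s = (m + 1) * eulerMaclaurinTerm m n s -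
      (aeval (1 : ℂ) (Polynomial.bernoulli (m + 1)) * ((n : ℂ) + 2) ^ (-(s + m)) -
        aeval (0 : ℂ) (Polynomial.bernoulli (m + 1)) * ((n : ℂ) + 1) ^ (-(s + m))) := by
  have h := intervalIntegral.integral_mul_deriv_eq_deriv_mul (a := 0) (b := 1)
    (u := fun y : ℝ => aeval (y : ℂ) (Polynomial.bernoulli (m + 1)))
    (v := fun y : ℝ => ((n : ℂ) + 1 + y) ^ (-(s + m)))
    (u' := fun y => (m + 1) * aeval (y : ℂ) (Polynomial.bernoulli m))
    (v' := fun y => -(s + m) * ((n : ℂ) + 1 + y) ^ (-(s + m) - 1))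
    (fun y _ => hasDerivAt_aeval_bernoulli m y)
    (fun y hy => by
      rw [Set.uIcc_of_le zero_le_one] at hy
      exact hasDerivAt_natCast_add_one_add_cpow n _ hy.1)
    (((continuous_aeval_ofReal _).const_mul _).intervalIntegrable _ _)
    (((continuousOn_natCast_add_one_add_cpow n _).const_mul _).intervalIntegrable)
  have e1 : ∀ y : ℝ, aeval (y : ℂ) (Polynomial.bernoulli (m + 1)) *
      (-(s + m) * ((n : ℂ) + 1 + y) ^ (-(s + m) - 1)) =
      -(s + m) * (aeval (y : ℂ) (Polynomial.bernoulli (m + 1)) *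
        ((n : ℂ) + 1 + y) ^ (-(s + (m + 1 : ℕ)))) := fun y => by
    rw [show -(s + ((m + 1 : ℕ) : ℂ)) = -(s + m) - 1 by push_cast; ring]
    ring
  have e2 : ∀ y : ℝ, (m + 1) * aeval (y : ℂ) (Polynomial.bernoulli m) *
      ((n : ℂ) + 1 + y) ^ (-(s + m)) = (m + 1) * (aeval (y : ℂ) (Polynomial.bernoulli m) *
        ((n : ℂ) + 1 + y) ^ (-(s + m))) := fun y => by ring
  simp only [e1, e2] at h
  rw [intervalIntegral.integral_const_mul, intervalIntegral.integral_const_mul] at h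
  simp only [Complex.ofReal_one, Complex.ofReal_zero, add_zero] at h
  rw [show (n : ℂ) + 1 + 1 = n + 2 by ring] at h
  rw [eulerMaclaurinTerm, eulerMaclaurinTerm]
  linear_combination -h

/-- The fundamental theorem of calculus on one interval. -/
theorem eulerMaclaurinTerm_zero (n : ℕ) (s : ℂ) :
    (1 - s) * eulerMaclaurinTerm 0 n s = ((n : ℂ) + 2) ^ (1 - s) - ((n : ℂ) + 1) ^ (1 - s) := by
  have h := intervalIntegral.integral_eq_sub_of_hasDerivAt (a := 0) (b := 1)
    (f := fun y : ℝ => ((n : ℂ) + 1 + y) ^ (1 - s))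
    (f' := fun y : ℝ => (1 - s) * ((n : ℂ) + 1 + y) ^ (1 - s - 1))
    (fun y hy => by
      rw [Set.uIcc_of_le zero_le_one] at hy
      exact hasDerivAt_natCast_add_one_add_cpow n _ hy.1)
    (((continuousOn_natCast_add_one_add_cpow n _).const_mul _).intervalIntegrable)
  rw [intervalIntegral.integral_const_mul] at h
  simp only [Complex.ofReal_one, Complex.ofReal_zero, add_zero] at h
  rw [show (n : ℂ) + 1 + 1 = n + 2 by ring] at h
  rw [← h, eulerMaclaurinTerm]
  simp [show 1 - s - 1 = -s by ring]

theorem exists_norm_aeval_le (p : ℚ[X]) :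
    ∃ M > 0, ∀ y ∈ Set.Icc (0 : ℝ) 1, ‖aeval (y : ℂ) p‖ ≤ M := by
  obtain ⟨M, hM⟩ := (isCompact_Icc (a := (0 : ℝ)) (b := 1)).exists_bound_of_continuousOn
    (continuous_aeval_ofReal p).continuousOn
  exact ⟨|M| + 1, by positivity, fun y hy => (hM y hy).trans ((le_abs_self M).trans (by linarith))⟩

theorem exists_norm_eulerMaclaurinTerm_le (m : ℕ) : ∃ M > 0, ∀ (n : ℕ) (s : ℂ) (σ : ℝ),
    0 ≤ σ → σ ≤ s.re + m → ‖eulerMaclaurinTerm m n s‖ ≤ M * (1 / ((n + 1 : ℕ) : ℝ) ^ σ) := by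
  obtain ⟨M, hM0, hM⟩ := exists_norm_aeval_le (Polynomial.bernoulli m)
  refine ⟨M, hM0, fun n s σ hσ hσs => ?_⟩
  have h := intervalIntegral.norm_integral_le_of_norm_le_const (a := 0) (b := 1)
    (f := fun y : ℝ => aeval (y : ℂ) (Polynomial.bernoulli m) *
      ((n : ℂ) + 1 + y) ^ (-(s + m))) (C := M * (1 / ((n + 1 : ℕ) : ℝ) ^ σ)) (fun y hy => by
      rw [Set.uIoc_of_le zero_le_one] at hy
      rw [norm_mul]
      have hn : (0 : ℝ) ≤ n := n.cast_nonneg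
      refine mul_le_mul (hM y ⟨hy.1.le, hy.2⟩) ?_ (norm_nonneg _) hM0.le
      rw [natCast_add_one_add_ofReal, Complex.norm_cpow_eq_rpow_re_of_pos (by linarith [hy.1]),
        one_div, ← Real.rpow_neg (by positivity)]
      have e1 : (-(s + m)).re ≤ -σ := by simp; linarith
      calc ((n : ℝ) + 1 + y) ^ (-(s + m)).re ≤ ((n : ℝ) + 1 + y) ^ (-σ) :=
            Real.rpow_le_rpow_of_exponent_le (by linarith [hy.1]) e1
        _ ≤ ((n + 1 : ℕ) : ℝ) ^ (-σ) := by
            refine Real.rpow_le_rpow_of_nonpos (by positivity) ?_ (by linarith)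
            push_cast
            linarith [hy.1])
  rwa [sub_zero, abs_one, mul_one] at h

theorem summable_one_div_nat_add_one_rpow {σ : ℝ} (hσ : 1 < σ) :
    Summable fun n : ℕ => 1 / ((n + 1 : ℕ) : ℝ) ^ σ :=
  (summable_nat_add_iff (f := fun n : ℕ => 1 / (n : ℝ) ^ σ) 1).2
    (Real.summable_one_div_nat_rpow.2 hσ)

theorem summable_eulerMaclaurinTerm {m : ℕ} {s : ℂ} (hs : 1 < s.re + m) :
    Summable fun n => eulerMaclaurinTerm m n s := by
  obtain ⟨M, -, hM⟩ := exists_norm_eulerMaclaurinTerm_le m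
  exact Summable.of_norm_bounded ((summable_one_div_nat_add_one_rpow hs).mul_left M) fun n =>
    hM n s _ (by linarith) le_rfl

theorem tendsto_natCast_add_one_cpow_neg {w : ℂ} (hw : 0 < w.re) :
    Tendsto (fun N : ℕ => ((N : ℂ) + 1) ^ (-w)) atTop (𝓝 0) := by
  rw [tendsto_zero_iff_norm_tendsto_zero]
  have h : ∀ N : ℕ, ‖((N : ℂ) + 1) ^ (-w)‖ = ((N : ℝ) + 1) ^ (-w.re) := fun N => by
    have := Complex.norm_cpow_eq_rpow_re_of_pos (x := (N : ℝ) + 1) (by positivity) (-w)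
    rw [Complex.neg_re] at this
    rw [← this]
    push_cast; rfl
  simp only [h]
  exact (tendsto_rpow_neg_atTop hw).comp
    (tendsto_atTop_add_const_right _ _ tendsto_natCast_atTop_atTop)

/-- The telescoping series of the boundary terms. -/
theorem tsum_cpow_sub_cpow {w : ℂ} (hw : 0 < w.re)
    (hs : Summable fun n : ℕ => ((n : ℂ) + 2) ^ (-w) - ((n : ℂ) + 1) ^ (-w)) :
    ∑' n : ℕ, (((n : ℂ) + 2) ^ (-w) - ((n : ℂ) + 1) ^ (-w)) = -1 := by
  refine tendsto_nhds_unique hs.hasSum.tendsto_sum_nat ?_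
  have h : ∀ N : ℕ, ∑ n ∈ Finset.range N, (((n : ℂ) + 2) ^ (-w) - ((n : ℂ) + 1) ^ (-w)) =
      ((N : ℂ) + 1) ^ (-w) - 1 := fun N => by
    have := Finset.sum_range_sub (fun n : ℕ => ((n : ℂ) + 1) ^ (-w)) N
    simp only [Nat.cast_zero, zero_add, Complex.one_cpow] at this
    rw [← this]
    refine Finset.sum_congr rfl fun n _ => ?_
    push_cast
    rw [show (n : ℂ) + 1 + 1 = n + 2 by ring]
  simp only [h]
  simpa using (tendsto_natCast_add_one_cpow_neg hw).sub_const 1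

theorem summable_natCast_add_one_cpow {w : ℂ} (hw : 1 < w.re) :
    Summable fun n : ℕ => ((n : ℂ) + 1) ^ (-w) := by
  have h := (summable_nat_add_iff (f := fun n : ℕ => 1 / (n : ℂ) ^ w) 1).2
    (Complex.summable_one_div_nat_cpow.2 hw)
  simpa only [Nat.cast_add, Nat.cast_one, one_div, ← Complex.cpow_neg] using h

theorem summable_natCast_add_two_cpow {w : ℂ} (hw : 1 < w.re) :
    Summable fun n : ℕ => ((n : ℂ) + 2) ^ (-w) := by
  have h := (summable_nat_add_iff (f := fun n : ℕ => ((n : ℂ) + 1) ^ (-w)) 1).2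
    (summable_natCast_add_one_cpow hw)
  simpa only [Nat.cast_add, Nat.cast_one, add_assoc, one_add_one_eq_two] using h

theorem bernoulli_eval_one_eq_eval_zero {m : ℕ} (hm : 2 ≤ m) :
    (Polynomial.bernoulli m).eval 1 = _root_.bernoulli m := by
  rw [Polynomial.bernoulli_eval_one, bernoulli_eq_bernoulli'_of_ne_one (by omega)]

/-- Integration by parts for the remainder integral. It needs `m ≥ 1`, as the boundary terms at
interior integers cancel only when `B_{m+1}(0) = B_{m+1}(1)`. -/
theorem eulerMaclaurinIntegral_succ {m : ℕ} (hm : 1 ≤ m) {s : ℂ} (hs : 1 < s.re + m) :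
    (s + m) * eulerMaclaurinIntegral (m + 1) s =
      (m + 1) * eulerMaclaurinIntegral m s + _root_.bernoulli (m + 1) := by
  have s1 : Summable fun n => eulerMaclaurinTerm (m + 1) n s :=
    summable_eulerMaclaurinTerm (by push_cast; linarith)
  have s2 : Summable fun n => eulerMaclaurinTerm m n s := summable_eulerMaclaurinTerm hs
  have hw : 0 < (s + m).re := by simp; linarith
  have key : ∀ n : ℕ, (s + m) * eulerMaclaurinTerm (m + 1) n s =
      (m + 1) * eulerMaclaurinTerm m n s - _root_.bernoulli (m + 1) *
        (((n : ℂ) + 2) ^ (-(s + m)) - ((n : ℂ) + 1) ^ (-(s + m))) := fun n => by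
    rw [eulerMaclaurinTerm_succ, aeval_one_eq, aeval_zero_eq,
      bernoulli_eval_one_eq_eval_zero (by omega), Polynomial.bernoulli_eval_zero]
    ring
  have s3 : Summable fun n : ℕ => ((n : ℂ) + 2) ^ (-(s + m)) - ((n : ℂ) + 1) ^ (-(s + m)) := by
    have hsm : 1 < (s + m).re := by simpa using hs
    exact (summable_natCast_add_two_cpow hsm).sub (summable_natCast_add_one_cpow hsm)
  rw [eulerMaclaurinIntegral, eulerMaclaurinIntegral, ← tsum_mul_left, ← tsum_mul_left]
  simp only [key]
  rw [(s2.mul_left _).tsum_sub (s3.mul_left _), tsum_mul_left (a := (_root_.bernoulli (m + 1) : ℂ)),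
    tsum_cpow_sub_cpow hw s3]
  ring

theorem riemannZeta_eq_sub_eulerMaclaurinIntegral_one {s : ℂ} (hs : 1 < s.re) :
    riemannZeta s = (s - 1)⁻¹ + 1 / 2 - s * eulerMaclaurinIntegral 1 s := by
  have h1 : s - 1 ≠ 0 := fun h => by
    rw [sub_eq_zero.1 h] at hs
    simp at hs
  have z0 := summable_natCast_add_one_cpow hs
  have z1 := summable_natCast_add_two_cpow hs
  have hz : riemannZeta s = ∑' n : ℕ, ((n : ℂ) + 1) ^ (-s) := by
    rw [zeta_eq_tsum_one_div_nat_add_one_cpow hs]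
    exact tsum_congr fun n => by rw [Complex.cpow_neg, one_div]
  have s0 : Summable fun n => eulerMaclaurinTerm 0 n s :=
    summable_eulerMaclaurinTerm (by simpa using hs)
  have t0 : ∑' n, eulerMaclaurinTerm 0 n s = (s - 1)⁻¹ := by
    have e : ∀ n : ℕ, (1 - s) * eulerMaclaurinTerm 0 n s =
        ((n : ℂ) + 2) ^ (-(s - 1)) - ((n : ℂ) + 1) ^ (-(s - 1)) := fun n => by
      rw [eulerMaclaurinTerm_zero, neg_sub]
    have h2 := tsum_cpow_sub_cpow (w := s - 1) (by simpa using hs)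
      ((s0.mul_left (1 - s)).congr e)
    rw [← tsum_congr e, tsum_mul_left] at h2
    refine eq_inv_of_mul_eq_one_left ?_
    linear_combination -h2
  have e2 : ∑' n : ℕ, (((n : ℂ) + 2) ^ (-s) - ((n : ℂ) + 1) ^ (-s)) = -1 :=
    tsum_cpow_sub_cpow (by linarith) (z1.sub z0)
  rw [z1.tsum_sub z0] at e2
  have key : ∀ n : ℕ, s * eulerMaclaurinTerm 1 n s = eulerMaclaurinTerm 0 n s -
      (1 / 2 * ((n : ℂ) + 2) ^ (-s) + 1 / 2 * ((n : ℂ) + 1) ^ (-s)) := fun n => by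
    have h := eulerMaclaurinTerm_succ 0 n s
    simp only [zero_add, Polynomial.bernoulli_one, map_sub, aeval_X, aeval_C, Nat.cast_zero,
      add_zero] at h
    have h2 : algebraMap ℚ ℂ 2⁻¹ = 1 / 2 := by simp
    rw [h, h2]
    ring
  rw [eulerMaclaurinIntegral, ← tsum_mul_left]
  simp only [key]
  rw [s0.tsum_sub ((z1.mul_left _).add (z0.mul_left _)), (z1.mul_left _).tsum_add (z0.mul_left _),
    tsum_mul_left, tsum_mul_left, t0, hz]
  linear_combination -(1 / 2 : ℂ) * e2

theorem differentiable_eulerMaclaurinTerm (m n : ℕ) : Differentiable ℂ (eulerMaclaurinTerm m n) := by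
  intro s₀
  obtain ⟨M, hM0, hM⟩ := exists_norm_aeval_le (Polynomial.bernoulli m)
  have hsub : Set.uIoc (0 : ℝ) 1 ⊆ Set.Icc 0 1 := by
    rw [Set.uIoc_of_le zero_le_one]; exact Set.Ioc_subset_Icc_self
  have hn : (0 : ℝ) ≤ n := n.cast_nonneg
  refine (intervalIntegral.hasDerivAt_integral_of_dominated_loc_of_deriv_le (a := 0) (b := 1)
    (μ := MeasureTheory.volume)
    (F := fun (s : ℂ) (y : ℝ) => aeval (y : ℂ) (Polynomial.bernoulli m) * ((n : ℂ) + 1 + y) ^ (-(s + m)))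
    (F' := fun (s : ℂ) (y : ℝ) => aeval (y : ℂ) (Polynomial.bernoulli m) *
      (((n : ℂ) + 1 + y) ^ (-(s + m)) * Complex.log ((n : ℂ) + 1 + y) * -1))
    (bound := fun _ => M * (((n : ℝ) + 2) ^ (‖s₀‖ + 1) * ((n : ℝ) + 2)))
    (Metric.ball_mem_nhds s₀ one_pos) ?_ ?_ ?_ ?_ intervalIntegrable_const
    ?_).2.differentiableAt
  · exact Eventually.of_forall fun s =>
      (intervalIntegrable_aeval_mul_cpow _ n _).aestronglyMeasurable_restrict_uIoc
  · exact intervalIntegrable_aeval_mul_cpow _ n _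
  · have hlog : ContinuousOn (fun y : ℝ => Complex.log ((n : ℂ) + 1 + y)) (Set.uIcc 0 1) := by
      intro y hy
      rw [Set.uIcc_of_le zero_le_one] at hy
      have : ContinuousAt (fun y : ℝ => (n : ℂ) + 1 + y) y := by fun_prop
      exact (this.clog (natCast_add_one_add_mem_slitPlane n hy.1)).continuousWithinAt
    exact (((continuous_aeval_ofReal _).continuousOn.mul
      (((continuousOn_natCast_add_one_add_cpow n _).mul hlog).mul continuousOn_const)).mono
        Set.uIoc_subset_uIcc).aestronglyMeasurable measurableSet_uIoc
  · refine Eventually.of_forall fun y hy s hs => ?_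
    have hy' := hsub hy
    have hb1 : 1 ≤ (n : ℝ) + 1 + y := by linarith [hy'.1]
    have hb2 : (n : ℝ) + 1 + y ≤ n + 2 := by linarith [hy'.2]
    rw [norm_mul, norm_mul, norm_mul, norm_neg, norm_one, mul_one]
    refine mul_le_mul (hM y hy') (mul_le_mul ?_ ?_ (norm_nonneg _) (by positivity))
      (by positivity) hM0.le
    · rw [natCast_add_one_add_ofReal, Complex.norm_cpow_eq_rpow_re_of_pos (by linarith)]
      have e1 : (-(s + m)).re ≤ ‖s₀‖ + 1 := by
        have h1 : ‖s‖ ≤ ‖s₀‖ + 1 := by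
          have := norm_add_le s₀ (s - s₀)
          rw [add_sub_cancel] at this
          have h2 : ‖s - s₀‖ < 1 := mem_ball_iff_norm.1 hs
          linarith
        have h3 : -s.re ≤ ‖s‖ := (neg_le_abs _).trans (Complex.abs_re_le_norm s)
        have h4 : (0 : ℝ) ≤ m := m.cast_nonneg
        simp only [Complex.neg_re, Complex.add_re, Complex.natCast_re]
        linarith
      exact (Real.rpow_le_rpow_of_exponent_le hb1 e1).trans
        (Real.rpow_le_rpow (by linarith) hb2 (by positivity))
    · rw [natCast_add_one_add_ofReal, ← Complex.ofReal_log (by linarith), Complex.norm_real,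
        Real.norm_of_nonneg (Real.log_nonneg hb1)]
      exact (Real.log_le_self (by linarith)).trans hb2
  · refine Eventually.of_forall fun y hy s _ => ?_
    have h0 : (n : ℂ) + 1 + y ≠ 0 :=
      Complex.slitPlane_ne_zero (natCast_add_one_add_mem_slitPlane n (hsub hy).1)
    exact ((((hasDerivAt_id s).add_const (m : ℂ)).neg).const_cpow (Or.inl h0)).const_mul _

theorem differentiableAt_eulerMaclaurinIntegral {m : ℕ} {s : ℂ} (hs : 1 < s.re + m) :
    DifferentiableAt ℂ (eulerMaclaurinIntegral m) s := by
  obtain ⟨M, -, hM⟩ := exists_norm_eulerMaclaurinTerm_le m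
  obtain ⟨σ, hσ1, hσ2⟩ := exists_between hs
  have hU : IsOpen {z : ℂ | σ - m < z.re} := isOpen_lt continuous_const Complex.continuous_re
  have hd : DifferentiableOn ℂ (eulerMaclaurinIntegral m) {z : ℂ | σ - m < z.re} :=
    Complex.differentiableOn_tsum_of_summable_norm
      ((summable_one_div_nat_add_one_rpow hσ1).mul_left M)
      (fun n => (differentiable_eulerMaclaurinTerm m n).differentiableOn) hU
      (fun n z hz => hM n z σ (by linarith) (by
        have : σ - m < z.re := hz
        linarith))
  exact hd.differentiableAt (hU.mem_nhds (show σ - m < s.re by linarith))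

/-- The polynomial part `1 / 2 + ∑ j ∈ [1, m], s (s + 1) ⋯ (s + j - 1) B_{j + 1} / (j + 1)!` of the
Euler–Maclaurin formula. -/
noncomputable def eulerMaclaurinPoly : ℕ → ℚ[X]
  | 0 => C (1 / 2)
  | m + 1 => eulerMaclaurinPoly m +
      C (_root_.bernoulli (m + 2) / (m + 2).factorial) * ascPochhammer ℚ (m + 1)

theorem aeval_ascPochhammer_succ (m : ℕ) (s : ℂ) :
    aeval s (ascPochhammer ℚ (m + 1)) = aeval s (ascPochhammer ℚ m) * (s + m) := by
  rw [ascPochhammer_succ_right]; simp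

theorem riemannZeta_eq_of_one_lt_re (m : ℕ) {s : ℂ} (hs : 1 < s.re) :
    riemannZeta s = (s - 1)⁻¹ + aeval s (eulerMaclaurinPoly m) -
      aeval s (ascPochhammer ℚ (m + 1)) / (m + 1).factorial * eulerMaclaurinIntegral (m + 1) s := by
  induction m with
  | zero =>
    rw [riemannZeta_eq_sub_eulerMaclaurinIntegral_one hs]
    simp [eulerMaclaurinPoly]
  | succ m ih =>
    have h := eulerMaclaurinIntegral_succ (m := m + 1) (by omega) (s := s) (by
      have : (0 : ℝ) ≤ (m + 1 : ℕ) := Nat.cast_nonneg _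
      linarith)
    have hf : ((m + 1).factorial : ℂ) ≠ 0 := by exact_mod_cast Nat.factorial_ne_zero _
    have hm : (m : ℂ) + 1 + 1 ≠ 0 := by exact_mod_cast Nat.succ_ne_zero (m + 1)
    have hfac : ((m + 1 + 1).factorial : ℂ) = ((m : ℂ) + 1 + 1) * (m + 1).factorial := by
      rw [Nat.factorial_succ]; push_cast; ring
    push_cast at h
    have hpoly : aeval s (eulerMaclaurinPoly (m + 1)) = aeval s (eulerMaclaurinPoly m) +
        (_root_.bernoulli (m + 2) / (m + 1 + 1).factorial : ℂ) *
          aeval s (ascPochhammer ℚ (m + 1)) := by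
      rw [eulerMaclaurinPoly, map_add, map_mul, aeval_C]
      simp
    rw [ih, hpoly, aeval_ascPochhammer_succ (m + 1), hfac]
    push_cast
    field_simp
    linear_combination (aeval s (ascPochhammer ℚ (m + 1))) * h

/-- The Euler–Maclaurin formula, continued analytically to `Re s > -m`. Here
`riemannZeta₀ s = ζ(s) - 1 / (s - 1)` with the singularity at `1` removed, so that both sides are
analytic on a convex domain. -/
theorem riemannZeta₀_eq_sub_eulerMaclaurinIntegral (m : ℕ) {s : ℂ} (hs : -(m : ℝ) < s.re) :
    riemannZeta₀ s = aeval s (eulerMaclaurinPoly m) -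
      aeval s (ascPochhammer ℚ (m + 1)) / (m + 1).factorial * eulerMaclaurinIntegral (m + 1) s := by
  set U : Set ℂ := {z | -(m : ℝ) < z.re} with hU
  have hUo : IsOpen U := isOpen_lt continuous_const Complex.continuous_re
  have hUc : Convex ℝ U := convex_halfSpace_re_gt _
  have hd : DifferentiableOn ℂ (fun s => aeval s (eulerMaclaurinPoly m) -
      aeval s (ascPochhammer ℚ (m + 1)) / (m + 1).factorial *
        eulerMaclaurinIntegral (m + 1) s) U := by
    intro z hz
    have hz' : -(m : ℝ) < z.re := hz
    refine ((Polynomial.differentiableAt_aeval _).sub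
      (((Polynomial.differentiableAt_aeval _).div_const _).mul
        (differentiableAt_eulerMaclaurinIntegral ?_))).differentiableWithinAt
    push_cast
    linarith
  have hm : (0 : ℝ) ≤ m := m.cast_nonneg
  refine (differentiable_riemannZeta₀.differentiableOn.analyticOnNhd
    hUo).eqOn_of_preconnected_of_eventuallyEq (hd.analyticOnNhd hUo) hUc.isPreconnected
    (z₀ := 2) (show -(m : ℝ) < (2 : ℂ).re by simp; linarith) ?_ hs
  have h2 : {z : ℂ | 1 < z.re} ∈ 𝓝 (2 : ℂ) :=
    (isOpen_lt continuous_const Complex.continuous_re).mem_nhds (by simp)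
  filter_upwards [h2] with z hz
  have h1 : z ≠ 1 := fun h => by
    have : 1 < z.re := hz
    rw [h] at this
    simp at this
  have h3 := riemannZeta_eq_of_one_lt_re m hz
  rw [riemannZeta_eq_inv_sub_add h1, add_sub_assoc] at h3
  exact add_left_cancel h3

theorem aeval_neg_ascPochhammer_self (k : ℕ) :
    aeval (-(k : ℂ)) (ascPochhammer ℚ k) = (-1) ^ k * (k.factorial : ℂ) := by
  have h1 : aeval (-(k : ℂ)) (ascPochhammer ℚ k) = (((ascPochhammer ℚ k).eval (-(k : ℚ)) : ℚ) : ℂ) := by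
    have := aeval_algebraMap_apply ℂ (-(k : ℚ)) (ascPochhammer ℚ k)
    simpa using this
  rw [h1, ascPochhammer_eval_neg_eq_descPochhammer, descPochhammer_eval_eq_descFactorial,
    Nat.descFactorial_self]
  push_cast
  rfl

/-- The Pochhammer polynomial `(s)_{k+2}` has a simple zero at `s = -k`. -/
theorem hasDerivAt_ascPochhammer_neg (k : ℕ) :
    HasDerivAt (fun s : ℂ => aeval s (ascPochhammer ℚ (k + 2)))
      ((-1) ^ k * (k.factorial : ℂ)) (-(k : ℂ)) := by
  -- The factor `s + k` vanishes at `-k`, and the last factor `s + k + 1` is `1` there.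
  have h : (fun s : ℂ => aeval s (ascPochhammer ℚ (k + 2))) = fun s : ℂ =>
      aeval s (ascPochhammer ℚ k) * ((s + k) * (s + (k + 1))) := by
    funext s
    rw [aeval_ascPochhammer_succ, aeval_ascPochhammer_succ]
    push_cast
    ring
  rw [h]
  have h1 := (Polynomial.hasDerivAt_aeval (ascPochhammer ℚ k) (-(k : ℂ))).fun_mul
    (((hasDerivAt_id (-(k : ℂ))).add_const (k : ℂ)).fun_mul
      ((hasDerivAt_id (-(k : ℂ))).add_const ((k : ℂ) + 1)))
  refine h1.congr_deriv ?_
  rw [aeval_neg_ascPochhammer_self]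
  simp

theorem deriv_riemannZeta_neg_eq_sub_eulerMaclaurinIntegral (k : ℕ) :
    deriv riemannZeta (-(k : ℂ)) = -1 / ((k : ℂ) + 1) ^ 2 +
      aeval (-(k : ℂ)) (derivative (eulerMaclaurinPoly (k + 1))) -
      (-1) ^ k * (k.factorial : ℂ) / (k + 2).factorial *
        eulerMaclaurinIntegral (k + 2) (-(k : ℂ)) := by
  have hk : (k : ℂ) + 1 ≠ 0 := Nat.cast_add_one_ne_zero k
  have hne : -(k : ℂ) - 1 ≠ 0 := fun h => hk (by linear_combination -h)
  have hG : DifferentiableAt ℂ (eulerMaclaurinIntegral (k + 2)) (-(k : ℂ)) :=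
    differentiableAt_eulerMaclaurinIntegral (by simp)
  have h1 : HasDerivAt (fun s : ℂ => (s - 1)⁻¹) (-1 / (-(k : ℂ) - 1) ^ 2) (-(k : ℂ)) :=
    ((hasDerivAt_id (-(k : ℂ))).sub_const 1).inv hne
  have h2 := (h1.fun_add (Polynomial.hasDerivAt_aeval (eulerMaclaurinPoly (k + 1)) (-(k : ℂ)))).fun_sub
    (((hasDerivAt_ascPochhammer_neg k).div_const ((k + 2).factorial : ℂ)).fun_mul hG.hasDerivAt)
  have hev : riemannZeta =ᶠ[𝓝 (-(k : ℂ))] fun s =>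
      (s - 1)⁻¹ + aeval s (eulerMaclaurinPoly (k + 1)) -
      aeval s (ascPochhammer ℚ (k + 2)) / (k + 2).factorial *
        eulerMaclaurinIntegral (k + 2) s := by
    have hU : {z : ℂ | -((k + 1 : ℕ) : ℝ) < z.re} ∈ 𝓝 (-(k : ℂ)) :=
      (isOpen_lt continuous_const Complex.continuous_re).mem_nhds (by simp)
    filter_upwards [hU, isOpen_ne.mem_nhds (sub_ne_zero.1 hne)] with s hs hs1
    rw [riemannZeta_eq_inv_sub_add hs1, riemannZeta₀_eq_sub_eulerMaclaurinIntegral (k + 1) hs]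
    ring
  rw [(h2.congr_of_eventuallyEq hev).deriv, aeval_ascPochhammer_succ, aeval_ascPochhammer_succ]
  have h3 : (-(k : ℂ) - 1) ^ 2 = ((k : ℂ) + 1) ^ 2 := by ring
  rw [h3]
  push_cast
  ring

theorem integral_aeval_bernoulli_succ (m : ℕ) :
    ∫ y in (0 : ℝ)..1, aeval (y : ℂ) (Polynomial.bernoulli (m + 1)) = 0 := by
  have h := intervalIntegral.integral_eq_sub_of_hasDerivAt (a := 0) (b := 1)
    (fun y _ => hasDerivAt_aeval_bernoulli (m + 1) y)
    (((continuous_aeval_ofReal _).const_mul _).intervalIntegrable _ _)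
  rw [intervalIntegral.integral_const_mul, Complex.ofReal_one, Complex.ofReal_zero, aeval_one_eq,
    aeval_zero_eq, bernoulli_eval_one_eq_eval_zero (by omega), Polynomial.bernoulli_eval_zero,
    sub_self] at h
  refine (mul_eq_zero.1 h).resolve_left ?_
  exact_mod_cast Nat.succ_ne_zero (m + 1)

/-- The remainder integral `∫ B_{k+2}({t}) / t ^ 2` in terms of `H`. The intermediate integral
`∫ B_{k+1}({t}) / t` converges only conditionally, so the subtraction of `1 / (n + 1)`, harmless since
`B_{k+1}` has mean zero, is made on each interval before summing. -/
theorem eulerMaclaurinIntegral_neg (k : ℕ) :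
    eulerMaclaurinIntegral (k + 2) (-(k : ℂ)) = _root_.bernoulli (k + 2) -
      (k + 2) * ∫ y in (0 : ℝ)..1,
        aeval (y : ℂ) (Polynomial.bernoulli (k + 1)) * complexHarmonic y := by
  have hsum := hasSum_integral_mul_complexHarmonic
    (continuous_aeval_ofReal (Polynomial.bernoulli (k + 1)))
  have key : ∀ n : ℕ, eulerMaclaurinTerm (k + 2) n (-(k : ℂ)) =
      -(k + 2) * (∫ y in (0 : ℝ)..1, aeval (y : ℂ) (Polynomial.bernoulli (k + 1)) *
        (1 / ((n : ℂ) + 1) - 1 / ((n : ℂ) + 1 + y))) -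
      _root_.bernoulli (k + 2) * (((n : ℂ) + 2) ^ (-1 : ℂ) - ((n : ℂ) + 1) ^ (-1 : ℂ)) := fun n => by
    have h := eulerMaclaurinTerm_succ (k + 1) n (-(k : ℂ))
    rw [aeval_one_eq, aeval_zero_eq, bernoulli_eval_one_eq_eval_zero (by omega),
      Polynomial.bernoulli_eval_zero] at h
    have e1 : -(k : ℂ) + ((k + 1 : ℕ) : ℂ) = 1 := by push_cast; ring
    have e2 : ∫ y in (0 : ℝ)..1, aeval (y : ℂ) (Polynomial.bernoulli (k + 1)) *
        (1 / ((n : ℂ) + 1) - 1 / ((n : ℂ) + 1 + y)) =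
        -eulerMaclaurinTerm (k + 1) n (-(k : ℂ)) := by
      have e3 : ∀ y : ℝ, aeval (y : ℂ) (Polynomial.bernoulli (k + 1)) *
          (1 / ((n : ℂ) + 1) - 1 / ((n : ℂ) + 1 + y)) =
          aeval (y : ℂ) (Polynomial.bernoulli (k + 1)) * (1 / ((n : ℂ) + 1)) -
          aeval (y : ℂ) (Polynomial.bernoulli (k + 1)) * ((n : ℂ) + 1 + y) ^ (-1 : ℂ) := fun y => by
        rw [Complex.cpow_neg_one]; ring
      simp only [e3]
      rw [intervalIntegral.integral_sub
        (((continuous_aeval_ofReal _).mul_const _).intervalIntegrable _ _)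
        (intervalIntegrable_aeval_mul_cpow _ n _), intervalIntegral.integral_mul_const,
        integral_aeval_bernoulli_succ, eulerMaclaurinTerm, e1]
      ring
    rw [e1, one_mul] at h
    rw [h, e2]
    push_cast
    ring
  have s1 : Summable fun n => eulerMaclaurinTerm (k + 2) n (-(k : ℂ)) :=
    summable_eulerMaclaurinTerm (by simp)
  have t1 : HasSum (fun n : ℕ => ((n : ℂ) + 2) ^ (-1 : ℂ) - ((n : ℂ) + 1) ^ (-1 : ℂ)) (-1) := by
    have hs : Summable fun n : ℕ => ((n : ℂ) + 2) ^ (-1 : ℂ) - ((n : ℂ) + 1) ^ (-1 : ℂ) := by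
      have h0 := (summable_complexHarmonic (x := 1) (by simp; norm_num)).neg
      refine h0.congr fun n => ?_
      rw [Complex.cpow_neg_one, Complex.cpow_neg_one, show (n : ℂ) + 1 + 1 = n + 2 by ring]
      ring
    exact hs.hasSum_iff.2 (tsum_cpow_sub_cpow (w := 1) (by simp) hs)
  rw [eulerMaclaurinIntegral]
  simp only [key]
  rw [((hsum.mul_left (-((k : ℂ) + 2))).sub (t1.mul_left (_root_.bernoulli (k + 2) : ℂ))).tsum_eq]
  ring

/-- The derivative of zeta at `-k` is, up to an explicit rational number, the integral of a
Bernoulli polynomial against `ψ (y + 1) + γ`. -/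
theorem deriv_riemannZeta_neg_eq (k : ℕ) :
    deriv riemannZeta (-(k : ℂ)) = -1 / ((k : ℂ) + 1) ^ 2 +
      aeval (-(k : ℂ)) (derivative (eulerMaclaurinPoly (k + 1))) -
      (-1) ^ k * _root_.bernoulli (k + 2) / (((k : ℂ) + 1) * (k + 2)) +
      (-1) ^ k / ((k : ℂ) + 1) * ∫ y in (0 : ℝ)..1,
        aeval (y : ℂ) (Polynomial.bernoulli (k + 1)) * complexHarmonic y := by
  have hk1 : (k : ℂ) + 1 ≠ 0 := Nat.cast_add_one_ne_zero k
  have hk2 : (k : ℂ) + 2 ≠ 0 := by exact_mod_cast Nat.succ_ne_zero (k + 1)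
  have hf : (k.factorial : ℂ) ≠ 0 := by exact_mod_cast Nat.factorial_ne_zero k
  have hfac : ((k + 2).factorial : ℂ) = ((k : ℂ) + 2) * (((k : ℂ) + 1) * k.factorial) := by
    rw [Nat.factorial_succ, Nat.factorial_succ]; push_cast; ring
  rw [deriv_riemannZeta_neg_eq_sub_eulerMaclaurinIntegral, eulerMaclaurinIntegral_neg, hfac]
  field_simp
  ring

/-! ### Evaluation of the Ramanujan sums -/

theorem deriv_riemannZeta_zero_eq_neg_log_sqrt :
    deriv riemannZeta 0 = -(Real.log (Real.sqrt (2 * π)) : ℂ) := by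
  rw [deriv_riemannZeta_zero, Real.log_sqrt (by positivity), Complex.ofReal_div,
    Complex.ofReal_log (by positivity)]
  push_cast
  ring

theorem exists_rat_deriv_riemannZeta_neg (k : ℕ) :
    ∃ r : ℚ, deriv riemannZeta (-(k : ℂ)) = r + (-1) ^ k / ((k : ℂ) + 1) *
      ∫ y in (0 : ℝ)..1, aeval (y : ℂ) (Polynomial.bernoulli (k + 1)) * complexHarmonic y := by
  refine ⟨-1 / ((k : ℚ) + 1) ^ 2 + (derivative (eulerMaclaurinPoly (k + 1))).eval (-(k : ℚ)) -
      (-1) ^ k * _root_.bernoulli (k + 2) / (((k : ℚ) + 1) * (k + 2)), ?_⟩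
  have h : aeval (-(k : ℂ)) (derivative (eulerMaclaurinPoly (k + 1))) =
      (((derivative (eulerMaclaurinPoly (k + 1))).eval (-(k : ℚ)) : ℚ) : ℂ) := by
    simpa using aeval_algebraMap_apply ℂ (-(k : ℚ)) (derivative (eulerMaclaurinPoly (k + 1)))
  rw [deriv_riemannZeta_neg_eq, h]
  push_cast
  ring

theorem aeval_bernoulli_add_one (k : ℕ) (x : ℂ) :
    aeval (x + 1) (Polynomial.bernoulli (k + 1)) =
      aeval x (Polynomial.bernoulli (k + 1)) + (k + 1) * x ^ k := by
  have h := congrArg (aeval x) (bernoulli_comp_one_add_X (k + 1))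
  rw [aeval_comp] at h
  simpa [add_comm] using h

/-- The Bernoulli polynomials form an Appell sequence. -/
theorem aeval_bernoulli_add_one_eq_sum (k : ℕ) (x : ℂ) :
    aeval (x + 1) (Polynomial.bernoulli (k + 1)) =
      1 + ∑ m ∈ Finset.range (k + 1),
        ((k + 1).choose (m + 1) : ℂ) * aeval x (Polynomial.bernoulli (m + 1)) := by
  have h := congrArg (aeval x) (Polynomial.sum_bernoulli k)
  rw [map_sum, aeval_monomial] at h
  simp only [map_smul] at h
  have h2 : ∑ j ∈ Finset.range (k + 1 + 1),
      ((k + 1).choose j : ℚ) • aeval x (Polynomial.bernoulli j) =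
      aeval (x + 1) (Polynomial.bernoulli (k + 1)) := by
    rw [Finset.sum_range_succ, h, aeval_bernoulli_add_one]
    simp
    ring
  rw [← h2, Finset.sum_range_succ']
  simp [Algebra.smul_def, add_comm]

theorem intervalIntegrable_aeval_mul_complexHarmonic (p : ℚ[X]) :
    IntervalIntegrable (fun y : ℝ => aeval (y : ℂ) p * complexHarmonic y)
      MeasureTheory.volume 0 1 :=
  ((continuous_aeval_ofReal p).continuousOn.mul
    continuousOn_complexHarmonic_ofReal).intervalIntegrable

/-- Here the antidifference is `(-1) ^ k B_{k+1}(x - 1) / (k + 1)`. -/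
theorem exists_rat_hasRamanujanSum_one_sub_pow_mul_harmonic (k : ℕ) :
    ∃ r : ℚ, HasRamanujanSum (fun n => (1 - (n : ℂ)) ^ k * (harmonic n : ℂ))
      (r + deriv riemannZeta (-(k : ℂ)) + (Real.eulerMascheroniConstant : ℂ) *
        ((((Polynomial.bernoulli (k + 1)).eval 2 : ℚ) : ℂ) / ((k : ℂ) + 1))) := by
  have hk : (k : ℂ) + 1 ≠ 0 := Nat.cast_add_one_ne_zero k
  set q : ℚ[X] := C ((-1) ^ k / ((k : ℚ) + 1)) * (Polynomial.bernoulli (k + 1)).comp (X - 1) with hq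
  have hqx : ∀ x : ℂ, aeval x q = (-1) ^ k / ((k : ℂ) + 1) *
      aeval (x - 1) (Polynomial.bernoulli (k + 1)) := fun x => by
    rw [hq, map_mul, aeval_C, aeval_comp]
    simp
  have hq0 : q.eval 0 = -((Polynomial.bernoulli (k + 1)).eval 2 / ((k : ℚ) + 1)) := by
    have h := Polynomial.bernoulli_eval_one_sub (k + 1) 2
    have h1 : ((-1 : ℚ) ^ k) * (-1) ^ k = 1 := by rw [← mul_pow]; norm_num
    rw [hq, eval_mul, eval_C, eval_comp]
    simp only [eval_sub, eval_X, eval_one]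
    rw [show (0 : ℚ) - 1 = 1 - 2 by norm_num, h, pow_succ]
    linear_combination (-(Polynomial.bernoulli (k + 1)).eval 2 / ((k : ℚ) + 1)) * h1
  obtain ⟨r, hr⟩ := exists_rat_hasRamanujanSum (p := (1 - X) ^ k) (q := q) (fun x => by
    have h := aeval_bernoulli_add_one k (x - 1)
    have h1 : (1 - x) ^ k = (-1) ^ k * (x - 1) ^ k := by rw [← mul_pow]; ring
    rw [hqx, hqx, show x + 1 - 1 = x - 1 + 1 by ring, h]
    simp only [map_pow, map_sub, map_one, aeval_X]
    rw [h1]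
    field_simp
    ring)
  obtain ⟨s, hs⟩ := exists_rat_deriv_riemannZeta_neg k
  refine ⟨r - s, ?_⟩
  have hint : ∫ y in (0 : ℝ)..1, aeval ((y : ℂ) + 1) q * complexHarmonic y =
      deriv riemannZeta (-(k : ℂ)) - s := by
    rw [hs, add_sub_cancel_left, ← intervalIntegral.integral_const_mul]
    refine intervalIntegral.integral_congr fun y _ => ?_
    simp only [hqx, add_sub_cancel_right]
    ring
  rw [hint, hq0] at hr
  convert hr using 1
  · funext n; simp
  · push_cast; ring

/-- Here the antidifference is `B_{k+1}(x) / (k + 1)`, and the Appell property expands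
`B_{k+1}(y + 1)` into the polynomials `B_{m+1}(y)` that produce `ζ'(-m)`. -/
theorem exists_rat_hasRamanujanSum_pow_mul_harmonic (k : ℕ) :
    ∃ r : ℚ, HasRamanujanSum (fun n => (n : ℂ) ^ k * (harmonic n : ℂ))
      (r + (Real.eulerMascheroniConstant : ℂ) *
          ((1 - (_root_.bernoulli (k + 1) : ℂ)) / ((k : ℂ) + 1)) +
        ∑ m ∈ Finset.range (k + 1),
          (k.choose m : ℂ) * (-1) ^ m * deriv riemannZeta (-(m : ℂ))) := by
  have hk : (k : ℂ) + 1 ≠ 0 := Nat.cast_add_one_ne_zero k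
  set q : ℚ[X] := C (1 / ((k : ℚ) + 1)) * Polynomial.bernoulli (k + 1) with hq
  have hqx : ∀ x : ℂ, aeval x q = 1 / ((k : ℂ) + 1) *
      aeval x (Polynomial.bernoulli (k + 1)) := fun x => by
    rw [hq, map_mul, aeval_C]
    simp
  have hq0 : q.eval 0 = _root_.bernoulli (k + 1) / ((k : ℚ) + 1) := by
    rw [hq, eval_mul, eval_C, Polynomial.bernoulli_eval_zero]
    ring
  obtain ⟨r, hr⟩ := exists_rat_hasRamanujanSum (p := X ^ k) (q := q) (fun x => by
    rw [hqx, hqx, aeval_bernoulli_add_one]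
    simp only [map_pow, aeval_X]
    field_simp
    ring)
  choose s hs using exists_rat_deriv_riemannZeta_neg
  refine ⟨r - ∑ m ∈ Finset.range (k + 1), k.choose m * (-1) ^ m * s m, ?_⟩
  have hterm : ∀ m : ℕ, 1 / ((k : ℂ) + 1) * (((k + 1).choose (m + 1) : ℂ) *
      ∫ y in (0 : ℝ)..1, aeval (y : ℂ) (Polynomial.bernoulli (m + 1)) * complexHarmonic y) =
      (k.choose m : ℂ) * (-1) ^ m * deriv riemannZeta (-(m : ℂ)) -
        k.choose m * (-1) ^ m * s m := fun m => by
    have hm : (m : ℂ) + 1 ≠ 0 := Nat.cast_add_one_ne_zero m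
    have h1 : ((-1 : ℂ) ^ m) * (-1) ^ m = 1 := by rw [← mul_pow]; norm_num
    have h2 : ((k : ℂ) + 1) * k.choose m = (k + 1).choose (m + 1) * (m + 1) := by
      exact_mod_cast Nat.add_one_mul_choose_eq k m
    have h3 : ((k + 1).choose (m + 1) : ℂ) / ((k : ℂ) + 1) = k.choose m / ((m : ℂ) + 1) := by
      rw [div_eq_div_iff hk hm]
      linear_combination -h2
    rw [hs m]
    linear_combination (∫ y in (0 : ℝ)..1, aeval (y : ℂ) (Polynomial.bernoulli (m + 1)) *
      complexHarmonic y) * (h3 - (k.choose m / ((m : ℂ) + 1)) * h1)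
  have hint : ∫ y in (0 : ℝ)..1, aeval ((y : ℂ) + 1) q * complexHarmonic y =
      (Real.eulerMascheroniConstant : ℂ) / ((k : ℂ) + 1) + ∑ m ∈ Finset.range (k + 1),
        ((k.choose m : ℂ) * (-1) ^ m * deriv riemannZeta (-(m : ℂ)) -
          k.choose m * (-1) ^ m * s m) := by
    have e : ∀ y : ℝ, aeval ((y : ℂ) + 1) q * complexHarmonic y = 1 / ((k : ℂ) + 1) *
        (complexHarmonic y + ∑ m ∈ Finset.range (k + 1), ((k + 1).choose (m + 1) : ℂ) *
          (aeval (y : ℂ) (Polynomial.bernoulli (m + 1)) * complexHarmonic y)) := fun y => by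
      rw [hqx, aeval_bernoulli_add_one_eq_sum, mul_assoc, add_mul, one_mul, Finset.sum_mul]
      simp only [mul_assoc]
    have hi : ∀ m ∈ Finset.range (k + 1), IntervalIntegrable (fun y : ℝ =>
        ((k + 1).choose (m + 1) : ℂ) * (aeval (y : ℂ) (Polynomial.bernoulli (m + 1)) *
          complexHarmonic y)) MeasureTheory.volume 0 1 := fun m _ =>
      (intervalIntegrable_aeval_mul_complexHarmonic _).const_mul _
    simp only [e]
    rw [intervalIntegral.integral_const_mul, intervalIntegral.integral_add
      continuousOn_complexHarmonic_ofReal.intervalIntegrable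
      (by simpa only [Finset.sum_fn] using IntervalIntegrable.sum _ hi),
      intervalIntegral.integral_finsetSum hi, integral_complexHarmonic, mul_add, Finset.mul_sum]
    simp only [intervalIntegral.integral_const_mul, hterm]
    ring
  rw [hint, hq0, Finset.sum_sub_distrib] at hr
  convert hr using 1
  · funext n; simp
  · push_cast; ring

/-- The exact value for `k = 0`, with the rational part computed: the antidifference and the
auxiliary polynomial are both `X`. -/
theorem hasRamanujanSum_harmonic : HasRamanujanSum (fun n => (harmonic n : ℂ))
    (3 / 2 * (Real.eulerMascheroniConstant : ℂ) - (Real.log (Real.sqrt (2 * π)) : ℂ) + 1 / 2) := by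
  have h := hasRamanujanSum_aeval_mul_harmonic (p := 1) (q := X) (Q := X) (q₀ := 0)
    (fun x => by simp) (fun x => by simp)
  simp only [aeval_X, map_one, one_mul, Rat.cast_zero, zero_mul, sub_zero] at h
  have h0 := deriv_riemannZeta_neg_eq 0
  have hpoly : aeval (0 : ℂ) (derivative (eulerMaclaurinPoly 1)) =
      ((_root_.bernoulli 2 : ℚ) : ℂ) / 2 := by
    simp [eulerMaclaurinPoly]
  simp only [Nat.cast_zero, neg_zero, zero_add, hpoly, deriv_riemannZeta_zero_eq_neg_log_sqrt,
    Polynomial.bernoulli_one, map_sub, aeval_X, aeval_C] at h0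
  have i1 : IntervalIntegrable (fun y : ℝ => (y : ℂ) * complexHarmonic y)
      MeasureTheory.volume 0 1 := by
    simpa using intervalIntegrable_aeval_mul_complexHarmonic X
  have i2 : IntervalIntegrable (fun y : ℝ => complexHarmonic y) MeasureTheory.volume 0 1 :=
    continuousOn_complexHarmonic_ofReal.intervalIntegrable
  have e1 : ∫ y in (0 : ℝ)..1, ((y : ℂ) - algebraMap ℚ ℂ 2⁻¹) * complexHarmonic y =
      (∫ y in (0 : ℝ)..1, (y : ℂ) * complexHarmonic y) -
        1 / 2 * (Real.eulerMascheroniConstant : ℂ) := by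
    have h2 : algebraMap ℚ ℂ 2⁻¹ = 1 / 2 := by simp
    simp only [sub_mul, h2]
    rw [intervalIntegral.integral_sub i1 (i2.const_mul _), intervalIntegral.integral_const_mul,
      integral_complexHarmonic]
  have e2 : ∫ y in (0 : ℝ)..1, ((y : ℂ) + 1) * complexHarmonic y =
      (∫ y in (0 : ℝ)..1, (y : ℂ) * complexHarmonic y) + (Real.eulerMascheroniConstant : ℂ) := by
    simp only [add_mul, one_mul]
    rw [intervalIntegral.integral_add i1 i2, integral_complexHarmonic]
  have e3 : ∫ y in (0 : ℝ)..1, ((y : ℂ) + 1) = 3 / 2 := by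
    have : ∀ y : ℝ, (y : ℂ) + 1 = ((y + 1 : ℝ) : ℂ) := fun y => by push_cast; rfl
    simp only [this]
    rw [intervalIntegral.integral_ofReal, intervalIntegral.integral_add (by simp) (by simp),
      integral_id, intervalIntegral.integral_const]
    norm_num
  rw [e1] at h0
  rw [e2, e3] at h
  convert h using 1
  linear_combination h0

end

theorem corollary1 :
    -- the Ramanujan sums exist and are unique
    (∀ k : ℕ, ∃! S : ℂ, HasRamanujanSum (fun n => (1 - (n : ℂ)) ^ k * (harmonic n : ℂ)) S) ∧
    (∀ k : ℕ, ∃! S : ℂ, HasRamanujanSum (fun n => (n : ℂ) ^ k * (harmonic n : ℂ)) S) ∧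
    -- the first formula, for `k ≥ 0`
    (∀ k : ℕ, EqModRat (deriv riemannZeta (-(k : ℂ)))
      (ramanujanSum (fun n => (1 - (n : ℂ)) ^ k * (harmonic n : ℂ)) -
        (Real.eulerMascheroniConstant : ℂ) *
          ((((Polynomial.bernoulli (k + 1)).eval 2 : ℚ) : ℂ) / ((k : ℂ) + 1)))) ∧
    -- its form for `k ≥ 1`
    (∀ k : ℕ, 1 ≤ k → EqModRat (deriv riemannZeta (-(k : ℂ)))
      (ramanujanSum (fun n => (1 - (n : ℂ)) ^ k * (harmonic n : ℂ)) -
        (Real.eulerMascheroniConstant : ℂ) *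
          ((bernoulli (k + 1) : ℂ) / ((k : ℂ) + 1) + 1))) ∧
    -- the second formula, for `k ≥ 1`
    (∀ k : ℕ, 1 ≤ k → EqModRat
      (ramanujanSum (fun n => (n : ℂ) ^ k * (harmonic n : ℂ)))
      ((Real.eulerMascheroniConstant : ℂ) * ((1 - (bernoulli (k + 1) : ℂ)) / ((k : ℂ) + 1)) -
        (Real.log (Real.sqrt (2 * π)) : ℂ) +
        ∑ m ∈ Finset.Icc 1 k,
          (k.choose m : ℂ) * (-1) ^ m * deriv riemannZeta (-(m : ℂ)))) ∧
    -- the exact value for `k = 0`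
    ramanujanSum (fun n => (harmonic n : ℂ)) =
      3 / 2 * (Real.eulerMascheroniConstant : ℂ) - (Real.log (Real.sqrt (2 * π)) : ℂ) + 1 / 2 := by
  have first : ∀ k : ℕ, EqModRat (deriv riemannZeta (-(k : ℂ)))
      (ramanujanSum (fun n => (1 - (n : ℂ)) ^ k * (harmonic n : ℂ)) -
        (Real.eulerMascheroniConstant : ℂ) *
          ((((Polynomial.bernoulli (k + 1)).eval 2 : ℚ) : ℂ) / ((k : ℂ) + 1))) := fun k => by
    obtain ⟨r, hr⟩ := exists_rat_hasRamanujanSum_one_sub_pow_mul_harmonic k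
    refine ⟨-r, ?_⟩
    rw [hr.ramanujanSum_eq]
    push_cast
    ring
  refine ⟨fun k => ?_, fun k => ?_, first, fun k hk => ?_, fun k hk => ?_,
    hasRamanujanSum_harmonic.ramanujanSum_eq⟩
  · obtain ⟨r, hr⟩ := exists_rat_hasRamanujanSum_one_sub_pow_mul_harmonic k
    exact ⟨_, hr, fun S hS => hS.unique hr⟩
  · obtain ⟨r, hr⟩ := exists_rat_hasRamanujanSum_pow_mul_harmonic k
    exact ⟨_, hr, fun S hS => hS.unique hr⟩
  · have h : (Polynomial.bernoulli (k + 1)).eval 2 = bernoulli (k + 1) + (k + 1) := by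
      have := Polynomial.bernoulli_eval_one_add (k + 1) 1
      rw [bernoulli_eval_one_eq_eval_zero (by omega)] at this
      norm_num at this
      exact this
    have hk1 : (k : ℂ) + 1 ≠ 0 := Nat.cast_add_one_ne_zero k
    convert first k using 3
    rw [h]
    push_cast
    field_simp
  · obtain ⟨r, hr⟩ := exists_rat_hasRamanujanSum_pow_mul_harmonic k
    refine ⟨r, ?_⟩
    have hI : Finset.Ico (0 + 1) (k + 1) = Finset.Icc 1 k := by
      ext m; simp
    rw [hr.ramanujanSum_eq, Finset.range_eq_Ico, Finset.sum_eq_sum_Ico_succ_bot (by omega), hI,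
      Nat.cast_zero, neg_zero, deriv_riemannZeta_zero_eq_neg_log_sqrt, Nat.choose_zero_right]
    push_cast
    ring
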